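/- Let $\hat{\mathcal H}$ be the space of all entire functions $f:\mathbb C\to\mathbb C$ with $\int |f(z)|^2 e^{-|z|^2}\,d\xi\,d\eta<\infty$ ($z=\xi+i\eta$), with inner product $\langle f|g\rangle=\frac1\pi\int\overline{f(z)}\,g(z)\,e^{-|z|^2}\,d\xi\,d\eta$. (1) The map sending $f\in\hat{\mathcal H}$ to its class identifies $\hat{\mathcal H}$ (injectively) with a closed subspace of $L^2_{\mathbb C}(\mathbb R^2,\frac1\pi e^{-(\xi^2+\eta^2)}d\xi\,d\eta)$; hence $\hat{\mathcal H}$ is a Hilbert space. (2) Every $f\in\hat{\mathcal H}$ has a unique power series representation $f(z)=\sum_{n\ge 0}a_nz^n$ on $\mathbb C$. For any complex sequence $(a_n)$, the power series $\sum a_nz^n$ converges for all $z\in\mathbb C$ and its sum belongs to $\hat{\mathcal H}$ if and only if $\sum_n|a_n|^2n!<\infty$. (3) The functions $\hat\phi_n(z)=\frac1{\sqrt{n!}}z^n$, $n=0,1,2,\dots$, form a complete orthonormal system of $\hat{\mathcal H}$. If $f=\sum_n a_nz^n\in\hat{\mathcal H}$, then $\langle\hat\phi_n|f\rangle=a_n\sqrt{n!}$,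 and $f=\sum_n\alpha_n\hat\phi_n$ holds in norm if and only if $\alpha_n=a_n\sqrt{n!}$ for all $n$. Let $\sigma>0$, $u^\sigma(x)=(2\pi\sigma^2)^{-1/4}e^{-x^2/(4\sigma^2)}$, $u^\sigma_{qp}(x)=e^{ipx}u^\sigma(x-q)$ for $q,p\in\mathbb R$, and $\mathcal H=L^2_{\mathbb C}(\mathbb R,dx)$, with inner products conjugate-linear in the first argument. (4) For every $\psi\in\mathcal H$ the function $(V\psi)(q,p)=\frac1{\sqrt{2\pi}}\langle u^\sigma_{qp}|\psi\rangle$ is infinitely differentiable on $\mathbb R^2$, and $V$ is a linear isometry of $\mathcal H$ into $L^2_{\mathbb C}(\mathbb R^2,dq\,dp)$; in particular $V\mathcal H$ is a Hilbert space. (5) With $z=\frac12\left(\frac q\sigma-2i\sigma p\right)$, the formula $$(\hat V\psi)(z)=\sqrt{2\pi}\,e^{|z|^2/2}e^{iqp/2}(V\psi)(q,p)=e^{|z|^2/2}e^{iqp/2}\langle u^\sigma_{qp}|\psi\rangle$$ defines a unitary map $\hat V$ from $\mathcal H$ onto $\hat{\mathcal H}$. (6) Let $m,\omega>0$ with $m\omega=\frac1{2\sigma^2}$.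 On Schwartz functions let $(Qf)(x)=xf(x)$, $P=-i\frac{d}{dx}$, $H=\frac1{2m}P^2+\frac{m\omega^2}2Q^2$ and $a^*=\frac1{\sqrt2}\left(\sqrt{m\omega}\,Q-\frac i{\sqrt{m\omega}}P\right)$, and let $\phi_n=\frac1{\sqrt{n!}}(a^*)^n u^{\sigma}$ be the usual energy eigenfunctions of the harmonic oscillator. Then $H\phi_n=\omega(n+\frac12)\phi_n$ and $\hat V\phi_n=\hat\phi_n$ for all $n=0,1,2,\dots$. -/

import Mathlib

open MeasureTheory SchwartzMap

noncomputable section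

/-! ### The Hilbert space of entire functions -/

/-- The measure `π⁻¹ exp(-|z|²) dξ dη` on `ℂ`, `z = ξ + iη`. -/
def bargmannMeasure : Measure ℂ :=
  volume.withDensity (fun z => ENNReal.ofReal (Real.pi⁻¹ * Real.exp (-‖z‖ ^ 2)))

theorem memLp_bargmannMeasure_iff {f : ℂ → ℂ} (hf : Continuous f) :
    MemLp f 2 bargmannMeasure ↔
      Integrable (fun z : ℂ => ‖f z‖ ^ 2 * Real.exp (-‖z‖ ^ 2)) := by
  rw [memLp_two_iff_integrable_sq_norm hf.aestronglyMeasurable, bargmannMeasure,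
    integrable_withDensity_iff_integrable_smul' (by fun_prop) (by simp)]
  have h : (fun z : ℂ => (ENNReal.ofReal (Real.pi⁻¹ * Real.exp (-‖z‖ ^ 2))).toReal • ‖f z‖ ^ 2)
      = fun z => Real.pi⁻¹ * (‖f z‖ ^ 2 * Real.exp (-‖z‖ ^ 2)) := by
    funext z
    rw [ENNReal.toReal_ofReal (by positivity), smul_eq_mul]
    ring
  rw [h]
  exact integrable_const_mul_iff (IsUnit.mk0 _ (by positivity)) _

/-- The vector space of all entire functions `f` with `∫ |f(z)|² exp(-|z|²) dξ dη < ∞`. -/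
def bargmannFunctions : Submodule ℂ (ℂ → ℂ) where
  carrier := {f | Differentiable ℂ f ∧
    Integrable (fun z : ℂ => ‖f z‖ ^ 2 * Real.exp (-‖z‖ ^ 2))}
  add_mem' := by
    rintro f g ⟨hf, hf'⟩ ⟨hg, hg'⟩
    exact ⟨hf.add hg, (memLp_bargmannMeasure_iff (hf.add hg).continuous).1
      (((memLp_bargmannMeasure_iff hf.continuous).2 hf').add
        ((memLp_bargmannMeasure_iff hg.continuous).2 hg'))⟩
  zero_mem' := ⟨differentiable_const 0, by simp⟩
  smul_mem' := by
    rintro c f ⟨hf, hf'⟩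
    exact ⟨hf.const_smul c, (memLp_bargmannMeasure_iff (hf.const_smul c).continuous).1
      (((memLp_bargmannMeasure_iff hf.continuous).2 hf').const_smul c)⟩

theorem memLp_of_mem_bargmannFunctions (f : bargmannFunctions) :
    MemLp (f : ℂ → ℂ) 2 bargmannMeasure :=
  (memLp_bargmannMeasure_iff f.2.1.continuous).2 f.2.2

/-- The map sending a square-integrable entire function to its class in
`L²(ℂ, π⁻¹ exp(-|z|²) dξ dη)`. -/
def bargmannToL2 : bargmannFunctions →ₗ[ℂ] Lp ℂ 2 bargmannMeasure where
  toFun f := (memLp_of_mem_bargmannFunctions f).toLp f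
  map_add' _ _ := rfl
  map_smul' _ _ := rfl

/-- The subspace of `L²(ℂ, π⁻¹ exp(-|z|²) dξ dη)` of all elements that can be represented by
entire functions, with the inner product of `L²`. -/
abbrev bargmannSpace : Submodule ℂ (Lp ℂ 2 bargmannMeasure) :=
  LinearMap.range bargmannToL2

/-- A square-integrable entire function as an element of `bargmannSpace`. -/
def bargmannClass (f : bargmannFunctions) : bargmannSpace :=
  ⟨bargmannToL2 f, LinearMap.mem_range_self bargmannToL2 f⟩

/-! ### Coherent states -/

theorem exists_pow_mul_gaussian_le (b : ℝ) (hb : 0 < b) (k : ℕ) (P : Polynomial ℝ) :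
    ∃ C : ℝ, ∀ x : ℝ, |x| ^ k * |P.eval x * Real.exp (-b * x ^ 2)| ≤ C := by
  induction P using Polynomial.induction_on' with
  | add P Q hP hQ =>
    obtain ⟨C, hC⟩ := hP
    obtain ⟨D, hD⟩ := hQ
    refine ⟨C + D, fun x => ?_⟩
    refine le_trans ?_ (add_le_add (hC x) (hD x))
    rw [Polynomial.eval_add, add_mul, ← mul_add]
    exact mul_le_mul_of_nonneg_left (abs_add_le _ _) (by positivity)
  | monomial n a =>
    refine ⟨|a| * ((k + n).factorial * Real.exp (1 / (4 * b))), fun x => ?_⟩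
    have h1 : |x| ^ (k + n) ≤ (k + n).factorial * Real.exp |x| := by
      have := Real.pow_div_factorial_le_exp |x| (abs_nonneg x) (k + n)
      rwa [div_le_iff₀ (by positivity), mul_comm] at this
    have h2 : |x| + -b * x ^ 2 ≤ 1 / (4 * b) := by
      rw [le_div_iff₀ (by positivity), ← sq_abs x]
      nlinarith [sq_nonneg (2 * b * |x| - 1)]
    rw [Polynomial.eval_monomial, abs_mul, abs_mul, abs_pow, Real.abs_exp]
    calc |x| ^ k * (|a| * |x| ^ n * Real.exp (-b * x ^ 2))
        = |a| * (|x| ^ (k + n) * Real.exp (-b * x ^ 2)) := by ring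
      _ ≤ |a| * ((k + n).factorial * Real.exp |x| * Real.exp (-b * x ^ 2)) := by gcongr
      _ = |a| * ((k + n).factorial * Real.exp (|x| + -b * x ^ 2)) := by
          rw [Real.exp_add]; ring
      _ ≤ _ := by gcongr

theorem iteratedDeriv_gaussian (b c : ℝ) (n : ℕ) :
    ∃ P : Polynomial ℝ, iteratedDeriv n (fun x : ℝ => c * Real.exp (-b * x ^ 2)) =
      fun x => P.eval x * Real.exp (-b * x ^ 2) := by
  induction n with
  | zero => exact ⟨Polynomial.C c, by simp⟩
  | succ n ih =>
    obtain ⟨P, hP⟩ := ih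
    refine ⟨Polynomial.derivative P + P * (Polynomial.C (-b * 2) * Polynomial.X), ?_⟩
    rw [iteratedDeriv_succ, hP]
    funext x
    have h := (P.hasDerivAt x).mul ((((hasDerivAt_id x).pow 2).const_mul (-b)).exp)
    have h' := h.deriv
    simp only [id, Nat.cast_ofNat] at h'
    simp only [Polynomial.eval_add, Polynomial.eval_mul, Polynomial.eval_C, Polynomial.eval_X]
    refine Eq.trans h' ?_
    simp
    ring

/-- The real Gaussian `c exp(-b x²)`, `b > 0`, as a Schwartz function. -/
def realGaussian (b c : ℝ) (hb : 0 < b) : 𝓢(ℝ, ℝ) where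
  toFun x := c * Real.exp (-b * x ^ 2)
  smooth' := by fun_prop
  decay' k n := by
    obtain ⟨P, hP⟩ := iteratedDeriv_gaussian b c n
    obtain ⟨C, hC⟩ := exists_pow_mul_gaussian_le b hb k P
    refine ⟨C, fun x => ?_⟩
    rw [norm_iteratedFDeriv_eq_norm_iteratedDeriv, hP]
    exact hC x

/-- The coherent state `u^σ(x) = (2πσ²)^(-1/4) exp(-x²/(4σ²))`, `σ > 0`, a Schwartz function. -/
def coherentState (σ : ℝ) (hσ : 0 < σ) : 𝓢(ℝ, ℂ) :=
  (realGaussian (1 / (4 * σ ^ 2)) ((2 * Real.pi * σ ^ 2) ^ (1 / 4 : ℝ))⁻¹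
    (by positivity)).postcompCLM Complex.ofRealCLM

theorem coherentState_apply (σ : ℝ) (hσ : 0 < σ) (x : ℝ) :
    coherentState σ hσ x =
      ((1 / (2 * Real.pi * σ ^ 2) ^ (1 / 4 : ℝ) * Real.exp (-(x ^ 2 / (4 * σ ^ 2))) : ℝ) : ℂ) := by
  have h : -(1 / (4 * σ ^ 2)) * x ^ 2 = -(x ^ 2 / (4 * σ ^ 2)) := by ring
  rw [← h, one_div ((2 * Real.pi * σ ^ 2) ^ (1 / 4 : ℝ))]
  rfl

/-- The shifted and boosted function `u_{qp}(x) = e^{ipx} u(x - q)`. -/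
def phaseShift (u : 𝓢(ℝ, ℂ)) (q p : ℝ) (x : ℝ) : ℂ :=
  Complex.exp (Complex.I * p * x) * u (x - q)

theorem memLp_phaseShift (u : 𝓢(ℝ, ℂ)) (q p : ℝ) :
    MemLp (phaseShift u q p) 2 (volume : Measure ℝ) := by
  have h : MemLp (fun x => u (x - q)) 2 (volume : Measure ℝ) :=
    (compSubConstCLM ℂ q u).memLp 2 volume
  refine (memLp_congr_norm ?_ h.1 ?_).2 h
  · have := u.continuous
    unfold phaseShift
    exact Continuous.aestronglyMeasurable (by fun_prop)
  · refine Filter.Eventually.of_forall fun x => ?_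
    have : Complex.I * p * x = ((p * x : ℝ) : ℂ) * Complex.I := by push_cast; ring
    simp only [phaseShift, norm_mul, this, Complex.norm_exp_ofReal_mul_I, one_mul]

/-- The vector `u_{qp}` of `L²(ℝ)`. -/
def phaseShiftL2 (u : 𝓢(ℝ, ℂ)) (q p : ℝ) : Lp ℂ 2 (volume : Measure ℝ) :=
  (memLp_phaseShift u q p).toLp (phaseShift u q p)

/-- The wave function `(Vψ)(q, p) = (2π)^(-1/2) ⟨u_{qp} | ψ⟩` on phase space; the inner product is
conjugate-linear in its first argument. -/
def phaseSpaceFunction (u : 𝓢(ℝ, ℂ)) (ψ : Lp ℂ 2 (volume : Measure ℝ)) (x : ℝ × ℝ) : ℂ :=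
  (1 / Real.sqrt (2 * Real.pi) : ℝ) * inner ℂ (phaseShiftL2 u x.1 x.2) ψ

/-- The point `z = (q/σ - 2iσp)/2` of the complex plane belonging to `(q, p)`. -/
def phasePoint (σ q p : ℝ) : ℂ :=
  (1 / 2) * ((q : ℂ) / σ - 2 * Complex.I * σ * p)

/-! ### The harmonic oscillator -/

/-- The position operator `(Qf)(x) = x f(x)` on Schwartz functions. -/
def positionOp : 𝓢(ℝ, ℂ) →L[ℂ] 𝓢(ℝ, ℂ) :=
  smulLeftCLM ℂ (fun x : ℝ => (x : ℂ))

theorem positionOp_apply (f : 𝓢(ℝ, ℂ)) (x : ℝ) : positionOp f x = x * f x := by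
  have h : (fun x : ℝ => (x : ℂ)).HasTemperateGrowth :=
    Complex.ofRealCLM.hasTemperateGrowth
  simp [positionOp, smulLeftCLM_apply_apply h]

/-- The momentum operator `P = -i d/dx` on Schwartz functions. -/
def momentumOp : 𝓢(ℝ, ℂ) →L[ℂ] 𝓢(ℝ, ℂ) :=
  (-Complex.I) • derivCLM ℂ ℂ

/-- The Hamiltonian `H = P²/(2m) + (mω²/2) Q²` of the harmonic oscillator on Schwartz functions. -/
def oscillatorHamiltonian (m ω : ℝ) : 𝓢(ℝ, ℂ) →L[ℂ] 𝓢(ℝ, ℂ) :=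
  ((1 / (2 * m) : ℝ) : ℂ) • (momentumOp ∘L momentumOp) +
    ((m * ω ^ 2 / 2 : ℝ) : ℂ) • (positionOp ∘L positionOp)

/-- The creation operator `a* = (√(mω) Q - (i/√(mω)) P)/√2` on Schwartz functions. -/
def creationOp (m ω : ℝ) : 𝓢(ℝ, ℂ) →L[ℂ] 𝓢(ℝ, ℂ) :=
  ((1 / Real.sqrt 2 : ℝ) : ℂ) •
    (((Real.sqrt (m * ω) : ℝ) : ℂ) • positionOp
      - (Complex.I / (Real.sqrt (m * ω) : ℝ)) • momentumOp)

/-- The energy eigenfunctions `φ_n = (n!)^(-1/2) (a*)^n φ_0` of the harmonic oscillator, with the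
ground state `φ_0 = u^σ`, `σ = 1/√(2mω)`. -/
def oscillatorEigenfunction (m ω : ℝ) (hm : 0 < m) (hω : 0 < ω) (n : ℕ) : 𝓢(ℝ, ℂ) :=
  ((1 / Real.sqrt n.factorial : ℝ) : ℂ) •
    (creationOp m ω)^[n] (coherentState (1 / Real.sqrt (2 * m * ω)) (by positivity))

end

/-! ### Parseval's identity on the circle -/

/-! On the side of entire functions everything follows from one norm formula. Restricted to the
circle of radius `r`, an entire function `f = ∑ aₙ zⁿ` is an absolutely convergent Fourier series
with coefficients `aₙ rⁿ`. Parseval's identity on each circle and the Gamma integral over the radius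
give `‖f‖² = ∑ |aₙ|² n!` (`lintegral_sq_bargmannMeasure`), as an identity in `[0, ∞]`. Hence
membership is the summability of the right side, a function of norm zero has no coefficients, and `α
↦ ∑ αₙ zⁿ / √n!` is an isometry of `ℓ²` onto the space. Completeness, closedness and the orthonormal
basis of monomials are carried over from `ℓ²`.

On the phase space side, `p ↦ ⟨u_{qp} | ψ⟩` is, up to scaling, the Fourier transform of `conj u(x -
q) ψ(x)`. Plancherel in `p` and Tonelli in `q` give `∫∫ |⟨u_{qp} | ψ⟩|² dq dp = 2π ‖u‖² ‖ψ‖²`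
(`lintegral_sq_inner_phaseShiftL2`), which makes `V` isometric. For the Gaussian `u^σ` the factor
`exp(|z|²/2 + iqp/2)` turns `conj u_{qp}` into a kernel holomorphic in `z`
(`exp_mul_conj_phaseShift`). So the transform of `ψ` is entire, `Vψ` is smooth, and the linear
change of variables `(q, p) ↦ z` makes the transform an isometry into the Hilbert space of entire
functions.

It is onto because it sends `u^σ` to `1` and turns `a*` into multiplication by `z`
(`bargmannTransform_creationOp`): each `φ_n` goes to a normalized monomial, and the closed range
contains a Hilbert basis. The energies come from the ladder relation `H a* = a* (H + ω)`. -/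

theorem integral_exp_mul_I_Ioo (k : ℤ) :
    ∫ θ in Set.Ioo (-Real.pi) Real.pi, Complex.exp (k * θ * Complex.I) =
      if k = 0 then ((2 * Real.pi : ℝ) : ℂ) else 0 := by
  rw [← integral_Ioc_eq_integral_Ioo, ← intervalIntegral.integral_of_le (by linarith [Real.pi_pos])]
  split_ifs with h
  · subst h
    simp
    ring
  · have hk : (k : ℂ) * Complex.I ≠ 0 := mul_ne_zero (by exact_mod_cast h) Complex.I_ne_zero
    have := integral_exp_mul_complex (a := -Real.pi) (b := Real.pi) hk
    have h2 : ∀ θ : ℝ, (k : ℂ) * θ * Complex.I = k * Complex.I * θ := fun θ => by ring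
    simp_rw [h2]
    rw [this]
    have h3 : Complex.exp (k * Complex.I * (Real.pi : ℝ)) =
        Complex.exp (k * Complex.I * ((-Real.pi : ℝ) : ℂ)) :=
      Complex.exp_eq_exp_iff_exists_int.2 ⟨k, by push_cast; ring⟩
    rw [h3, sub_self, zero_div]

theorem integrableOn_circle_of_continuous {E : Type*} [NormedAddCommGroup E] {f : ℝ → E}
    (hf : Continuous f) : IntegrableOn f (Set.Ioo (-Real.pi) Real.pi) :=
  (hf.integrableOn_Icc).mono_set Set.Ioo_subset_Icc_self

theorem norm_exp_int_mul_I (k : ℤ) (θ : ℝ) : ‖Complex.exp (k * θ * Complex.I)‖ = 1 := by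
  have := Complex.norm_exp_ofReal_mul_I (k * θ)
  push_cast at this
  exact this

/-- The factors `h n` are left general because Parseval needs two cases: exponentials alone, and
exponentials times the conjugate of the sum. -/
theorem hasSum_integral_circle {c : ℕ → ℂ} (hc : Summable fun n => ‖c n‖) {h : ℕ → ℝ → ℂ}
    (hh : ∀ n, Continuous (h n)) {C : ℝ} (hC : ∀ n θ, ‖h n θ‖ ≤ C) :
    HasSum (fun n => c n * ∫ θ in Set.Ioo (-Real.pi) Real.pi, h n θ)
      (∫ θ in Set.Ioo (-Real.pi) Real.pi, ∑' n, c n * h n θ) := by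
  have key := hasSum_integral_of_summable_integral_norm
    (μ := volume.restrict (Set.Ioo (-Real.pi) Real.pi)) (F := fun n θ => c n * h n θ)
    (fun n => integrableOn_circle_of_continuous (continuous_const.mul (hh n))) ?_
  · simpa only [integral_const_mul] using key
  · refine Summable.of_nonneg_of_le (fun n => integral_nonneg fun _ => norm_nonneg _) (fun n => ?_)
      (hc.mul_right (C * (2 * Real.pi)))
    have h1 : ∫ θ in Set.Ioo (-Real.pi) Real.pi, ‖c n * h n θ‖ ≤
        ∫ θ in Set.Ioo (-Real.pi) Real.pi, ‖c n‖ * C := by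
      refine integral_mono (integrableOn_circle_of_continuous (by have := hh n; fun_prop))
        (integrable_const _) fun θ => ?_
      simp only [norm_mul]
      exact mul_le_mul_of_nonneg_left (hC n θ) (norm_nonneg _)
    refine h1.trans (le_of_eq ?_)
    rw [setIntegral_const, measureReal_def, Real.volume_Ioo,
      ENNReal.toReal_ofReal (by linarith [Real.pi_pos]), smul_eq_mul]
    ring

theorem continuous_tsum_mul_exp {c : ℕ → ℂ} (hc : Summable fun n => ‖c n‖) :
    Continuous fun θ : ℝ => ∑' n : ℕ, c n * Complex.exp ((n : ℤ) * θ * Complex.I) :=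
  continuous_tsum (fun n => by fun_prop) hc fun n θ => by
    rw [norm_mul, norm_exp_int_mul_I, mul_one]

/-- Parseval's identity for an absolutely convergent one-sided Fourier series. -/
theorem hasSum_sq_circle {c : ℕ → ℂ} (hc : Summable fun n => ‖c n‖) :
    HasSum (fun n => 2 * Real.pi * ‖c n‖ ^ 2)
      (∫ θ in Set.Ioo (-Real.pi) Real.pi,
        ‖∑' n : ℕ, c n * Complex.exp ((n : ℤ) * θ * Complex.I)‖ ^ 2) := by
  set g : ℝ → ℂ := fun θ => ∑' n : ℕ, c n * Complex.exp ((n : ℤ) * θ * Complex.I) with hg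
  have hgc : Continuous g := continuous_tsum_mul_exp hc
  have hgb : ∀ θ, ‖g θ‖ ≤ ∑' n, ‖c n‖ := fun θ => by
    refine tsum_of_norm_bounded hc.hasSum fun n => ?_
    rw [norm_mul, norm_exp_int_mul_I, mul_one]
  -- Orthogonality of the exponentials leaves only the term `n = k`.
  have coeff : ∀ k : ℕ, ∫ θ in Set.Ioo (-Real.pi) Real.pi,
      Complex.exp (((-k : ℤ) : ℂ) * θ * Complex.I) * g θ = 2 * Real.pi * c k := by
    intro k
    have h1 := hasSum_integral_circle hc
      (h := fun n θ => Complex.exp ((((n : ℤ) - k : ℤ) : ℂ) * θ * Complex.I)) (C := 1)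
      (fun n => by fun_prop) (fun n θ => (norm_exp_int_mul_I _ θ).le)
    simp only [integral_exp_mul_I_Ioo, sub_eq_zero, Nat.cast_inj] at h1
    have h2 : HasSum (fun n => c n * if n = k then ((2 * Real.pi : ℝ) : ℂ) else 0)
        (2 * Real.pi * c k) := by
      convert hasSum_ite_eq k (2 * Real.pi * c k) using 2 with n
      split_ifs with h
      · subst h
        push_cast
        ring
      · ring
    · rw [← h1.unique h2]
      refine integral_congr_ae (Filter.Eventually.of_forall fun θ => ?_)
      simp only [hg, ← tsum_mul_left]
      refine tsum_congr fun n => ?_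
      rw [mul_left_comm, ← Complex.exp_add]
      push_cast
      ring_nf
  -- Only one of the two factors of `|g|²` is expanded; the integrals against the conjugate of `g`
  -- are then known from `coeff`, so no double series occurs.
  have h3 := hasSum_integral_circle hc
    (h := fun n θ => Complex.exp ((n : ℤ) * θ * Complex.I) * starRingEnd ℂ (g θ))
    (C := ∑' n, ‖c n‖) (fun n => by fun_prop) (fun n θ => by
      rw [norm_mul, norm_exp_int_mul_I, one_mul, RCLike.norm_conj]; exact hgb θ)
  have h4 : ∀ k : ℕ, ∫ θ in Set.Ioo (-Real.pi) Real.pi,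
      Complex.exp ((k : ℤ) * θ * Complex.I) * starRingEnd ℂ (g θ) =
        starRingEnd ℂ (2 * Real.pi * c k) := by
    intro k
    rw [← coeff k, ← integral_conj]
    refine integral_congr_ae (Filter.Eventually.of_forall fun θ => ?_)
    simp only [map_mul, ← Complex.exp_conj, Complex.conj_I, Complex.conj_ofReal]
    simp
  simp only [h4] at h3
  have h5 : HasSum (fun n => ((2 * Real.pi * ‖c n‖ ^ 2 : ℝ) : ℂ))
      ((∫ θ in Set.Ioo (-Real.pi) Real.pi, ‖g θ‖ ^ 2 : ℝ) : ℂ) := by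
    rw [← integral_complex_ofReal]
    convert h3 using 1
    · funext n
      push_cast
      rw [← Complex.mul_conj']
      simp only [map_mul, Complex.conj_ofReal, Complex.conj_ofNat]
      ring
    · refine integral_congr_ae (Filter.Eventually.of_forall fun θ => ?_)
      simp only [← mul_assoc, tsum_mul_right]
      push_cast
      rw [← Complex.mul_conj']
      rfl
  have h6 := Complex.hasSum_ofReal.1 h5
  exact h6

theorem lintegral_sq_circle {c : ℕ → ℂ} (hc : Summable fun n => ‖c n‖) :
    ∫⁻ θ in Set.Ioo (-Real.pi) Real.pi,
        ‖∑' n : ℕ, c n * Complex.exp ((n : ℤ) * θ * Complex.I)‖ₑ ^ 2 =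
      ∑' n, ENNReal.ofReal (2 * Real.pi * ‖c n‖ ^ 2) := by
  have h := hasSum_sq_circle hc
  rw [← ENNReal.ofReal_tsum_of_nonneg (fun n => by positivity) h.summable, h.tsum_eq,
    ofReal_integral_eq_lintegral_ofReal]
  · refine lintegral_congr fun θ => ?_
    rw [ENNReal.ofReal_pow (norm_nonneg _), ofReal_norm]
  · refine integrableOn_circle_of_continuous ?_
    have := continuous_tsum_mul_exp hc
    fun_prop
  · exact Filter.Eventually.of_forall fun θ => by positivity

/-! ### The norm of a power series -/

/-- The integrand is `2c² r^(2n+1) exp(-r²)`, and `2 ∫ r^(2n+1) exp(-r²) dr = Γ(n+1)`. The first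
factor `r` is the polar Jacobian, `2π` comes from Parseval. -/
theorem lintegral_radial_moment (n : ℕ) (c : ℝ) :
    ∫⁻ r in Set.Ioi (0 : ℝ), ENNReal.ofReal
      (r * (Real.pi⁻¹ * Real.exp (-r ^ 2)) * (2 * Real.pi * (c * r ^ n) ^ 2)) =
      ENNReal.ofReal (c ^ 2 * n.factorial) := by
  have h0 : (-1 : ℝ) < ((2 * n + 1 : ℕ) : ℝ) := lt_of_lt_of_le (by norm_num) (Nat.cast_nonneg _)
  have h1 := integral_rpow_mul_exp_neg_rpow (p := 2) (q := ((2 * n + 1 : ℕ) : ℝ)) (by norm_num) h0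
  have h2 : Real.Gamma ((((2 * n + 1 : ℕ) : ℝ) + 1) / 2) = n.factorial := by
    rw [← Real.Gamma_nat_eq_factorial]
    congr 1
    push_cast
    ring
  have hi : IntegrableOn (fun r : ℝ => r ^ (((2 * n + 1 : ℕ) : ℝ)) * Real.exp (-r ^ (2 : ℝ)))
      (Set.Ioi 0) := integrableOn_rpow_mul_exp_neg_rpow h0 (by norm_num)
  rw [h2] at h1
  have h3 : ∫⁻ r in Set.Ioi (0 : ℝ), ENNReal.ofReal
      (2 * c ^ 2 * (r ^ (((2 * n + 1 : ℕ) : ℝ)) * Real.exp (-r ^ (2 : ℝ)))) =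
        ENNReal.ofReal (c ^ 2 * n.factorial) := by
    rw [← ofReal_integral_eq_lintegral_ofReal (hi.const_mul _), integral_const_mul, h1]
    · congr 1
      ring
    · refine (ae_restrict_iff' measurableSet_Ioi).2 (Filter.Eventually.of_forall fun r hr => ?_)
      have : (0 : ℝ) < r := hr
      positivity
  rw [← h3]
  refine setLIntegral_congr_fun measurableSet_Ioi fun r hr => ?_
  congr 1
  rw [Real.rpow_natCast, Real.rpow_ofNat]
  have := Real.pi_pos.ne'
  field_simp
  ring

theorem lintegral_bargmannMeasure (F : ℂ → ENNReal) (hF : Measurable F) :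
    ∫⁻ z, F z ∂bargmannMeasure =
      ∫⁻ z, ENNReal.ofReal (Real.pi⁻¹ * Real.exp (-‖z‖ ^ 2)) * F z := by
  rw [bargmannMeasure, lintegral_withDensity_eq_lintegral_mul _ (by fun_prop) hF]
  rfl

/-- Convergence at the single point `‖z‖ + 1` is already absolute in `ℂ` and dominates the series on
the ball of that radius, so the Weierstrass theorem applies near `z`. -/
theorem differentiable_of_hasSum_pow {a : ℕ → ℂ} {f : ℂ → ℂ}
    (hf : ∀ z, HasSum (fun n => a n * z ^ n) (f z)) : Differentiable ℂ f := by
  have h : f = fun z => ∑' n, a n * z ^ n := funext fun z => (hf z).tsum_eq.symm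
  intro z
  have hs : Summable fun n => ‖a n‖ * (‖z‖ + 1) ^ n := by
    have := (hf ((‖z‖ + 1 : ℝ) : ℂ)).summable.norm
    refine this.congr fun n => ?_
    rw [norm_mul, norm_pow, Complex.norm_real, Real.norm_of_nonneg (by positivity)]
  have hd := Complex.differentiableOn_tsum_of_summable_norm (F := fun n w => a n * w ^ n) hs
    (fun n => Differentiable.differentiableOn (by fun_prop))
    (Metric.isOpen_ball (x := (0 : ℂ)) (ε := ‖z‖ + 1)) fun n w hw => by
      rw [norm_mul, norm_pow]
      have : ‖w‖ ≤ ‖z‖ + 1 := (mem_ball_zero_iff.1 hw).le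
      gcongr
  rw [h]
  exact hd.differentiableAt (Metric.isOpen_ball.mem_nhds (by simp))

/-- The squared norm of an entire function in terms of its Taylor coefficients. -/
theorem lintegral_sq_bargmannMeasure {a : ℕ → ℂ} {f : ℂ → ℂ}
    (hf : ∀ z, HasSum (fun n => a n * z ^ n) (f z)) :
    ∫⁻ z, ‖f z‖ₑ ^ 2 ∂bargmannMeasure = ∑' n, ENNReal.ofReal (‖a n‖ ^ 2 * n.factorial) := by
  have hfc : Continuous f := (differentiable_of_hasSum_pow hf).continuous
  rw [lintegral_bargmannMeasure _ (by fun_prop), ← Complex.lintegral_comp_polarCoord_symm,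
    polarCoord_target, Measure.volume_eq_prod, setLIntegral_prod]
  swap
  · refine Measurable.aemeasurable ?_
    have : Measurable fun p : ℝ × ℝ => Complex.polarCoord.symm p := by
      simp only [Complex.polarCoord_symm_apply]
      fun_prop
    have h2 : Measurable fun z : ℂ =>
      ENNReal.ofReal (Real.pi⁻¹ * Real.exp (-‖z‖ ^ 2)) * ‖f z‖ₑ ^ 2 := by fun_prop
    exact (ENNReal.measurable_ofReal.comp measurable_fst).mul (h2.comp this)
  -- The weight is constant on the circle of radius `r`, so the angular integral is Parseval with
  -- coefficients `aₙ rⁿ`.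
  have inner : ∀ r ∈ Set.Ioi (0 : ℝ), ∫⁻ θ in Set.Ioo (-Real.pi) Real.pi, ENNReal.ofReal r •
      (ENNReal.ofReal (Real.pi⁻¹ * Real.exp (-‖Complex.polarCoord.symm (r, θ)‖ ^ 2)) *
        ‖f (Complex.polarCoord.symm (r, θ))‖ₑ ^ 2) =
      ∑' n, ENNReal.ofReal
        (r * (Real.pi⁻¹ * Real.exp (-r ^ 2)) * (2 * Real.pi * (‖a n‖ * r ^ n) ^ 2)) := by
    intro r hr
    have hr : 0 < r := hr
    have hs : Summable fun n => ‖a n * (r : ℂ) ^ n‖ := (hf r).summable.norm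
    have h1 := lintegral_sq_circle hs
    have h2 : ∀ θ : ℝ, f (Complex.polarCoord.symm (r, θ)) =
        ∑' n : ℕ, a n * (r : ℂ) ^ n * Complex.exp ((n : ℤ) * θ * Complex.I) := by
      intro θ
      rw [← (hf _).tsum_eq]
      refine tsum_congr fun n => ?_
      rw [Complex.polarCoord_symm_apply]
      simp only
      rw [Complex.ofReal_cos, Complex.ofReal_sin, ← Complex.exp_mul_I, mul_pow,
        ← Complex.exp_nat_mul]
      push_cast
      ring_nf
    have h3 : ∀ θ : ℝ, ‖Complex.polarCoord.symm (r, θ)‖ = r := fun θ => by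
      rw [Complex.norm_polarCoord_symm, abs_of_pos hr]
    simp only [h2, h3, smul_eq_mul]
    rw [lintegral_const_mul', lintegral_const_mul', h1, ← ENNReal.tsum_mul_left,
      ← ENNReal.tsum_mul_left]
    · refine tsum_congr fun n => ?_
      rw [← ENNReal.ofReal_mul (by positivity), ← ENNReal.ofReal_mul (by positivity), norm_mul,
        norm_pow, Complex.norm_real, Real.norm_of_nonneg hr.le]
      congr 1
      ring
    · exact ENNReal.ofReal_ne_top
    · exact ENNReal.ofReal_ne_top
  -- All terms are nonnegative, so sum and integral commute with no finiteness assumption on `f`.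
  rw [setLIntegral_congr_fun measurableSet_Ioi inner, lintegral_tsum]
  · exact tsum_congr fun n => lintegral_radial_moment n _
  · intro n
    fun_prop

/-! ### The space of entire functions as a sequence space -/

theorem memLp_bargmannMeasure_iff_summable {a : ℕ → ℂ} {f : ℂ → ℂ}
    (hf : ∀ z, HasSum (fun n => a n * z ^ n) (f z)) :
    MemLp f 2 bargmannMeasure ↔ Summable fun n => ‖a n‖ ^ 2 * (n.factorial : ℝ) := by
  have hfc : Continuous f := (differentiable_of_hasSum_pow hf).continuous
  have h0 : ∀ n, 0 ≤ ‖a n‖ ^ 2 * (n.factorial : ℝ) := fun n => by positivity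
  have h1 : MemLp f 2 bargmannMeasure ↔ ∫⁻ z, ‖f z‖ₑ ^ 2 ∂bargmannMeasure < ⊤ := by
    rw [MemLp, and_iff_right hfc.aestronglyMeasurable,
      eLpNorm_lt_top_iff_lintegral_rpow_enorm_lt_top (by norm_num) (by norm_num)]
    simp
  rw [h1, lintegral_sq_bargmannMeasure hf, lt_top_iff_ne_top]
  constructor
  · intro h
    have := ENNReal.summable_toReal h
    refine this.congr fun n => ENNReal.toReal_ofReal (h0 n)
  · intro h
    rw [← ENNReal.ofReal_tsum_of_nonneg h0 h]
    exact ENNReal.ofReal_ne_top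

theorem mem_bargmannFunctions_iff_summable {a : ℕ → ℂ} {f : ℂ → ℂ}
    (hf : ∀ z, HasSum (fun n => a n * z ^ n) (f z)) :
    f ∈ bargmannFunctions ↔ Summable fun n => ‖a n‖ ^ 2 * (n.factorial : ℝ) := by
  have hd := differentiable_of_hasSum_pow hf
  rw [← memLp_bargmannMeasure_iff_summable hf, memLp_bargmannMeasure_iff hd.continuous]
  exact ⟨fun h => h.2, fun h => ⟨hd, h⟩⟩

theorem norm_sq_bargmannToL2_eq_lintegral (f : bargmannFunctions) :
    ENNReal.ofReal (‖bargmannToL2 f‖ ^ 2) = ∫⁻ z, ‖f.1 z‖ₑ ^ 2 ∂bargmannMeasure := by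
  have h : ‖bargmannToL2 f‖ = (eLpNorm f.1 2 bargmannMeasure).toReal := 
    Lp.norm_toLp _ (memLp_of_mem_bargmannFunctions f)
  rw [h, ENNReal.ofReal_pow ENNReal.toReal_nonneg,
    ENNReal.ofReal_toReal (memLp_of_mem_bargmannFunctions f).2.ne]
  have := eLpNorm_nnreal_pow_eq_lintegral (f := f.1) (μ := bargmannMeasure) (p := 2) (by norm_num)
  simpa using this

theorem hasSum_norm_sq_bargmannToL2 {a : ℕ → ℂ} (f : bargmannFunctions)
    (hf : ∀ z, HasSum (fun n => a n * z ^ n) (f.1 z)) :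
    HasSum (fun n => ‖a n‖ ^ 2 * (n.factorial : ℝ)) (‖bargmannToL2 f‖ ^ 2) := by
  have h0 : ∀ n, 0 ≤ ‖a n‖ ^ 2 * (n.factorial : ℝ) := fun n => by positivity
  have hs := (mem_bargmannFunctions_iff_summable hf).1 f.2
  have h := norm_sq_bargmannToL2_eq_lintegral f
  rw [lintegral_sq_bargmannMeasure hf, ← ENNReal.ofReal_tsum_of_nonneg h0 hs,
    ENNReal.ofReal_eq_ofReal_iff (by positivity) (tsum_nonneg h0)] at h
  rw [h]
  exact hs.hasSum

theorem exists_hasSum_pow {f : ℂ → ℂ} (hf : Differentiable ℂ f) :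
    ∃ a : ℕ → ℂ, ∀ z, HasSum (fun n => a n * z ^ n) (f z) := by
  refine ⟨fun n => (n.factorial : ℂ)⁻¹ * iteratedDeriv n f 0, fun z => ?_⟩
  have := Complex.hasSum_taylorSeries_of_entire hf 0 z
  simp only [sub_zero, smul_eq_mul] at this
  have h : ∀ n : ℕ, (n.factorial : ℂ)⁻¹ * iteratedDeriv n f 0 * z ^ n =
      (n.factorial : ℂ)⁻¹ * (z ^ n * iteratedDeriv n f 0) := fun n => by ring
  simpa only [h] using this

/-- The differences `aₙ - bₙ` are coefficients of the zero function, and the norm formula makes each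
of them vanish. -/
theorem coeff_eq_of_hasSum_pow {a b : ℕ → ℂ} {f : ℂ → ℂ}
    (ha : ∀ z, HasSum (fun n => a n * z ^ n) (f z))
    (hb : ∀ z, HasSum (fun n => b n * z ^ n) (f z)) : a = b := by
  have h : ∀ z : ℂ, HasSum (fun n => (a n - b n) * z ^ n) ((0 : bargmannFunctions).1 z) := by
    intro z
    simpa [sub_mul] using (ha z).sub (hb z)
  have h1 := hasSum_norm_sq_bargmannToL2 0 h
  rw [map_zero, norm_zero, zero_pow two_ne_zero,
    hasSum_zero_iff_of_nonneg (fun n => by positivity)] at h1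
  funext n
  have h2 := congrFun h1 n
  have h3 : (n.factorial : ℝ) ≠ 0 := by positivity
  simpa [h3, sub_eq_zero] using h2

theorem injective_bargmannToL2 : Function.Injective bargmannToL2 := by
  rw [injective_iff_map_eq_zero]
  intro f hf
  obtain ⟨a, ha⟩ := exists_hasSum_pow f.2.1
  have h1 := hasSum_norm_sq_bargmannToL2 f ha
  rw [hf, norm_zero, zero_pow two_ne_zero,
    hasSum_zero_iff_of_nonneg (fun n => by positivity)] at h1
  have h2 : ∀ n, a n = 0 := fun n => by
    have h3 : (n.factorial : ℝ) ≠ 0 := by positivity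
    simpa [h3] using congrFun h1 n
  ext z
  exact (ha z).unique (by simp [h2, hasSum_zero])

/-- Splitting `|aₙ zⁿ| = (|aₙ| √n!) (|z|ⁿ / √n!)` and using `xy ≤ x² + y²` bounds the series by the
hypothesis plus the series of `exp(|z|²)`. -/
theorem summable_mul_pow_of_summable {a : ℕ → ℂ}
    (ha : Summable fun n => ‖a n‖ ^ 2 * (n.factorial : ℝ)) (z : ℂ) :
    Summable fun n => a n * z ^ n := by
  have h := ha.add (Real.summable_pow_div_factorial (‖z‖ ^ 2))
  refine Summable.of_norm_bounded h fun n => ?_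
  have hn : (0 : ℝ) < n.factorial := by positivity
  have h1 : (Real.sqrt n.factorial) ^ 2 = n.factorial := Real.sq_sqrt hn.le
  have h2 : 0 < Real.sqrt n.factorial := Real.sqrt_pos.2 hn
  have h3 : ‖a n * z ^ n‖ = (‖a n‖ * Real.sqrt n.factorial) * (‖z‖ ^ n / Real.sqrt n.factorial) := by
    rw [norm_mul, norm_pow]
    field_simp
  have h4 : ‖a n‖ ^ 2 * n.factorial + (‖z‖ ^ 2) ^ n / n.factorial =
      (‖a n‖ * Real.sqrt n.factorial) ^ 2 + (‖z‖ ^ n / Real.sqrt n.factorial) ^ 2 := by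
    rw [mul_pow, div_pow, h1]
    ring
  rw [h3, h4]
  have h5 : 0 ≤ ‖a n‖ * Real.sqrt n.factorial := by positivity
  have h6 : 0 ≤ ‖z‖ ^ n / Real.sqrt n.factorial := by positivity
  nlinarith [sq_nonneg (‖a n‖ * Real.sqrt n.factorial - ‖z‖ ^ n / Real.sqrt n.factorial)]

theorem summable_and_mem_bargmannFunctions_iff (a : ℕ → ℂ) :
    ((∀ z : ℂ, Summable (fun n => a n * z ^ n)) ∧
      (fun z : ℂ => ∑' n, a n * z ^ n) ∈ bargmannFunctions) ↔
        Summable (fun n => ‖a n‖ ^ 2 * (n.factorial : ℝ)) := by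
  constructor
  · rintro ⟨h, h'⟩
    exact (mem_bargmannFunctions_iff_summable fun z => (h z).hasSum).1 h'
  · intro h
    have h1 := summable_mul_pow_of_summable h
    exact ⟨h1, (mem_bargmannFunctions_iff_summable fun z => (h1 z).hasSum).2 h⟩

/-- The coefficient `α / √n!` of `zⁿ` belonging to the coefficient `α` of `zⁿ / √n!`. -/
noncomputable def normalizedCoeff (α : ℕ → ℂ) (n : ℕ) : ℂ :=
  α n / (Real.sqrt n.factorial : ℝ)

theorem norm_sq_normalizedCoeff (α : ℕ → ℂ) (n : ℕ) :
    ‖normalizedCoeff α n‖ ^ 2 * (n.factorial : ℝ) = ‖α n‖ ^ 2 := by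
  have hn : (0 : ℝ) < n.factorial := by positivity
  rw [normalizedCoeff, norm_div, div_pow, Complex.norm_real, Real.norm_eq_abs, sq_abs,
    Real.sq_sqrt hn.le, div_mul_cancel₀ _ hn.ne']

theorem summable_normalizedCoeff (α : lp (fun _ : ℕ => ℂ) 2) :
    Summable fun n => ‖normalizedCoeff α n‖ ^ 2 * (n.factorial : ℝ) := by
  simp only [norm_sq_normalizedCoeff]
  have := (lp.memℓp α).summable (by norm_num)
  simpa using this

theorem hasSum_normalizedCoeff (α : lp (fun _ : ℕ => ℂ) 2) (z : ℂ) :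
    HasSum (fun n => normalizedCoeff α n * z ^ n) (∑' n, normalizedCoeff α n * z ^ n) :=
  (summable_mul_pow_of_summable (summable_normalizedCoeff α) z).hasSum

/-- The square-integrable entire function `∑ αₙ zⁿ / √n!`. -/
noncomputable def bargmannOfCoeff : lp (fun _ : ℕ => ℂ) 2 →ₗ[ℂ] bargmannFunctions where
  toFun α := ⟨fun z => ∑' n, normalizedCoeff α n * z ^ n,
    ((summable_and_mem_bargmannFunctions_iff _).2 (summable_normalizedCoeff α)).2⟩
  map_add' α β := by
    ext z
    refine HasSum.tsum_eq ?_
    have h : ∀ n, normalizedCoeff (α + β : lp (fun _ : ℕ => ℂ) 2) n * z ^ n =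
        normalizedCoeff α n * z ^ n + normalizedCoeff β n * z ^ n := fun n => by
      simp [normalizedCoeff, add_div, add_mul]
    simp only [h]
    exact (hasSum_normalizedCoeff α z).add (hasSum_normalizedCoeff β z)
  map_smul' c α := by
    ext z
    refine HasSum.tsum_eq ?_
    have h : ∀ n, normalizedCoeff (c • α : lp (fun _ : ℕ => ℂ) 2) n * z ^ n =
        c * (normalizedCoeff α n * z ^ n) := fun n => by
      simp [normalizedCoeff, mul_div_assoc, mul_assoc]
    simp only [h]
    exact (hasSum_normalizedCoeff α z).mul_left c

theorem hasSum_bargmannOfCoeff (α : lp (fun _ : ℕ => ℂ) 2) (z : ℂ) :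
    HasSum (fun n => normalizedCoeff α n * z ^ n) ((bargmannOfCoeff α).1 z) :=
  hasSum_normalizedCoeff α z

/-- The isometry `α ↦ ∑ αₙ zⁿ / √n!` of `ℓ²` into the space of entire functions. -/
noncomputable def bargmannIsometry : lp (fun _ : ℕ => ℂ) 2 →ₗᵢ[ℂ] bargmannSpace where
  toLinearMap := bargmannToL2.rangeRestrict ∘ₗ bargmannOfCoeff
  norm_map' α := by
    have h := hasSum_norm_sq_bargmannToL2 _ (hasSum_bargmannOfCoeff α)
    simp only [norm_sq_normalizedCoeff] at h
    have h2 := lp.norm_rpow_eq_tsum (p := 2) (by norm_num) α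
    simp only [ENNReal.toReal_ofNat, Real.rpow_ofNat] at h2
    rw [h.tsum_eq] at h2
    exact ((sq_eq_sq₀ (norm_nonneg _) (norm_nonneg _)).1 h2).symm

theorem bargmannIsometry_apply (α : lp (fun _ : ℕ => ℂ) 2) :
    bargmannIsometry α = bargmannClass (bargmannOfCoeff α) := rfl

theorem exists_bargmannOfCoeff_eq {a : ℕ → ℂ} (f : bargmannFunctions)
    (hf : ∀ z, HasSum (fun n => a n * z ^ n) (f.1 z)) :
    ∃ α : lp (fun _ : ℕ => ℂ) 2, bargmannOfCoeff α = f ∧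
      ∀ n, α n = a n * (Real.sqrt n.factorial : ℝ) := by
  have hs := (mem_bargmannFunctions_iff_summable hf).1 f.2
  have hn : ∀ n : ℕ, ((Real.sqrt n.factorial : ℝ) : ℂ) ≠ 0 := fun n => by
    have : (0 : ℝ) < n.factorial := by positivity
    exact_mod_cast (Real.sqrt_pos.2 this).ne'
  have hm : Memℓp (fun n => a n * ((Real.sqrt n.factorial : ℝ) : ℂ)) 2 := by
    refine memℓp_gen ?_
    refine hs.congr fun n => ?_
    have hn : (0 : ℝ) ≤ n.factorial := by positivity
    rw [norm_mul, Complex.norm_real, Real.norm_eq_abs, ENNReal.toReal_ofNat, Real.rpow_ofNat,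
      mul_pow, sq_abs, Real.sq_sqrt hn]
  refine ⟨⟨_, hm⟩, ?_, fun n => rfl⟩
  ext z
  refine (hasSum_bargmannOfCoeff _ z).unique ?_
  convert hf z using 2 with n
  simp only [normalizedCoeff]
  rw [mul_div_cancel_right₀ _ (hn n)]

theorem surjective_bargmannIsometry : Function.Surjective bargmannIsometry := by
  rintro ⟨_, f, rfl⟩
  obtain ⟨a, ha⟩ := exists_hasSum_pow f.2.1
  obtain ⟨α, hα, -⟩ := exists_bargmannOfCoeff_eq f ha
  exact ⟨α, by rw [bargmannIsometry_apply, hα]; rfl⟩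

/-- The Hilbert basis of normalized monomials. -/
noncomputable def bargmannBasis : HilbertBasis ℕ ℂ bargmannSpace :=
  HilbertBasis.ofRepr
    (LinearIsometryEquiv.ofSurjective bargmannIsometry surjective_bargmannIsometry).symm

/-- The normalized monomial `zⁿ / √n!`. -/
noncomputable def bargmannMonomial (n : ℕ) : bargmannFunctions :=
  bargmannOfCoeff (lp.single 2 n (1 : ℂ))

theorem bargmannMonomial_apply (n : ℕ) (z : ℂ) :
    (bargmannMonomial n).1 z = (1 / Real.sqrt n.factorial : ℝ) * z ^ n := by
  refine (hasSum_bargmannOfCoeff _ z).unique ?_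
  convert hasSum_single n ?_ using 1
  · simp [normalizedCoeff]
  · intro m hm
    simp [normalizedCoeff, hm]

theorem bargmannBasis_apply (n : ℕ) : bargmannBasis n = bargmannClass (bargmannMonomial n) := by
  rw [← bargmannBasis.repr_symm_single]
  rfl

theorem bargmannBasis_repr (f : bargmannFunctions) {a : ℕ → ℂ}
    (hf : ∀ z, HasSum (fun n => a n * z ^ n) (f.1 z)) (n : ℕ) :
    bargmannBasis.repr (bargmannClass f) n = a n * (Real.sqrt n.factorial : ℝ) := by
  obtain ⟨α, rfl, hα⟩ := exists_bargmannOfCoeff_eq f hf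
  have h : bargmannBasis.repr (bargmannClass (bargmannOfCoeff α)) = α :=
    (LinearIsometryEquiv.ofSurjective bargmannIsometry
      surjective_bargmannIsometry).symm_apply_apply α
  rw [← hα, h]

/-- Uniqueness: pairing a norm convergent expansion with `b i` is continuous and isolates `α i`. -/
theorem HilbertBasis.hasSum_smul_iff {ι 𝕜 E : Type*} [RCLike 𝕜] [NormedAddCommGroup E]
    [InnerProductSpace 𝕜 E] (b : HilbertBasis ι 𝕜 E) (x : E) (α : ι → 𝕜) :
    HasSum (fun i => α i • b i) x ↔ ∀ i, α i = b.repr x i := by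
  classical
  constructor
  · intro h i
    have h1 := h.mapL (innerSL 𝕜 (b i))
    rw [b.repr_apply_apply]
    refine (HasSum.unique h1 ?_).symm
    convert hasSum_ite_eq i (α i) using 2 with j
    have h2 := orthonormal_iff_ite.1 b.orthonormal i j
    simp only [innerSL_apply_apply, inner_smul_right, h2, mul_ite, mul_one, mul_zero]
    by_cases hij : i = j
    · subst hij
      simp
    · rw [if_neg hij, if_neg (Ne.symm hij)]
  · intro h
    simpa only [h] using b.hasSum_repr x

instance completeSpace_bargmannSpace : CompleteSpace bargmannSpace :=
  let e := LinearIsometryEquiv.ofSurjective bargmannIsometry surjective_bargmannIsometry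
  (completeSpace_congr (e := e.toEquiv) e.isometry.isUniformEmbedding).1 inferInstance

theorem isClosed_bargmannSpace : IsClosed (bargmannSpace : Set (Lp ℂ 2 bargmannMeasure)) :=
  (completeSpace_coe_iff_isComplete.1 completeSpace_bargmannSpace).isClosed

theorem inner_bargmannClass (f g : bargmannFunctions) :
    inner ℂ (bargmannClass f) (bargmannClass g) =
      (1 / Real.pi : ℝ) * ∫ z : ℂ, starRingEnd ℂ (f.1 z) * g.1 z * Real.exp (-‖z‖ ^ 2) := by
  have h1 : inner ℂ (bargmannClass f) (bargmannClass g) =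
      ∫ z, starRingEnd ℂ (f.1 z) * g.1 z ∂bargmannMeasure := by
    rw [Submodule.coe_inner, L2.inner_def]
    refine integral_congr_ae ?_
    filter_upwards [(memLp_of_mem_bargmannFunctions f).coeFn_toLp,
      (memLp_of_mem_bargmannFunctions g).coeFn_toLp] with z hf hg
    have hf' : (bargmannClass f : Lp ℂ 2 bargmannMeasure) z = f.1 z := hf
    have hg' : (bargmannClass g : Lp ℂ 2 bargmannMeasure) z = g.1 z := hg
    rw [hf', hg', RCLike.inner_apply, mul_comm]
  rw [h1, bargmannMeasure, integral_withDensity_eq_integral_toReal_smul (by fun_prop) (by simp),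
    ← integral_const_mul]
  refine integral_congr_ae (Filter.Eventually.of_forall fun z => ?_)
  simp only
  rw [ENNReal.toReal_ofReal (by positivity), Complex.real_smul]
  push_cast
  ring

/-! ### Plancherel's theorem for integrable functions -/

section Plancherel

open FourierTransform

theorem continuous_fourier_of_integrable {f : ℝ → ℂ} (hf : Integrable f) : Continuous (𝓕 f) :=
  VectorFourier.fourierIntegral_continuous Real.continuous_fourierChar
    (by exact continuous_inner) hf

/-- The `L²` Fourier transform agrees with the distributional one, and the integral transform
satisfies `∫ 𝓕g · f = ∫ g · 𝓕f`. Hence both have the same integrals against smooth compactly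
supported functions. -/
theorem coeFn_fourier_toLp {f : ℝ → ℂ} (h1 : Integrable f) (h2 : MemLp f 2) :
    ((𝓕 (h2.toLp f) : Lp ℂ 2 (volume : Measure ℝ)) : ℝ → ℂ) =ᵐ[volume] 𝓕 f := by
  refine ae_eq_of_integral_contDiff_smul_eq ?_ ?_ fun g hg hgs => ?_
  · exact (Lp.memLp (𝓕 (h2.toLp f) : Lp ℂ 2 (volume : Measure ℝ))).locallyIntegrable (by norm_num)
  · exact (continuous_fourier_of_integrable h1).locallyIntegrable
  have hgc : ContDiff ℝ ((⊤ : ℕ∞) : WithTop ℕ∞) fun x => (g x : ℂ) :=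
    Complex.ofRealCLM.contDiff.comp hg
  have hgcs : HasCompactSupport fun x => (g x : ℂ) := hgs.comp_left (g := Complex.ofReal) rfl
  have e := Lp.fourier_toTemperedDistribution_eq (h2.toLp f)
  have e1 := congrArg (fun T => T (hgcs.toSchwartzMap hgc)) e
  simp only [TemperedDistribution.fourier_apply, Lp.toTemperedDistribution_apply] at e1
  have e2 : ∫ x, g x • (𝓕 (h2.toLp f) : Lp ℂ 2 volume) x =
      ∫ x, (hgcs.toSchwartzMap hgc) x • (𝓕 (h2.toLp f) : Lp ℂ 2 volume) x := by
    refine integral_congr_ae (Filter.Eventually.of_forall fun x => ?_)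
    simp
  rw [e2, ← e1]
  have e3 := VectorFourier.integral_fourierIntegral_smul_eq_flip (L := innerₗ ℝ)
    (μ := volume) (ν := volume) Real.continuous_fourierChar continuous_inner
    (hgcs.toSchwartzMap hgc).integrable h1
  have e4 : ∫ x, (𝓕 (hgcs.toSchwartzMap hgc)) x • (h2.toLp f : Lp ℂ 2 volume) x =
      ∫ x, 𝓕 (hgcs.toSchwartzMap hgc : ℝ → ℂ) x • f x := by
    refine integral_congr_ae ?_
    filter_upwards [h2.coeFn_toLp] with x hx
    rw [hx, SchwartzMap.fourier_coe]
  rw [e4]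
  refine Eq.trans e3 ?_
  refine integral_congr_ae (Filter.Eventually.of_forall fun x => ?_)
  simp only [flip_innerₗ, HasCompactSupport.toSchwartzMap_toFun, Complex.real_smul, smul_eq_mul]
  rfl

/-- Plancherel's theorem for functions in `L¹ ∩ L²`. -/
theorem lintegral_sq_fourier {f : ℝ → ℂ} (h1 : Integrable f) (h2 : MemLp f 2) :
    ∫⁻ ξ, ‖𝓕 f ξ‖ₑ ^ 2 = ∫⁻ x, ‖f x‖ₑ ^ 2 := by
  have h : eLpNorm (𝓕 f) 2 volume = eLpNorm f 2 volume := by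
    rw [← eLpNorm_congr_ae (coeFn_fourier_toLp h1 h2), ← eLpNorm_congr_ae h2.coeFn_toLp,
      ← Lp.enorm_def, ← Lp.enorm_def, ← ofReal_norm, ← ofReal_norm, Lp.norm_fourier_eq]
  have e1 := eLpNorm_nnreal_pow_eq_lintegral (f := 𝓕 f) (μ := volume) (p := 2) (by norm_num)
  have e2 := eLpNorm_nnreal_pow_eq_lintegral (f := f) (μ := volume) (p := 2) (by norm_num)
  simp only [ENNReal.coe_ofNat, NNReal.coe_ofNat, ENNReal.rpow_ofNat] at e1 e2
  rw [← e1, ← e2, h]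

theorem lintegral_comp_mul_left {g : ℝ → ENNReal} (hg : Measurable g) {a : ℝ} (ha : a ≠ 0) :
    ∫⁻ x, g x = ENNReal.ofReal |a| * ∫⁻ x, g (a * x) := by
  conv_lhs => rw [← Real.smul_map_volume_mul_left ha]
  rw [lintegral_smul_measure, lintegral_map hg (by fun_prop), smul_eq_mul]

end Plancherel

/-! ### Orthogonality relations of the shifted states -/

theorem inner_phaseShiftL2 (u : 𝓢(ℝ, ℂ)) (q p : ℝ) (ψ : Lp ℂ 2 (volume : Measure ℝ)) :
    inner ℂ (phaseShiftL2 u q p) ψ = ∫ x, starRingEnd ℂ (phaseShift u q p x) * ψ x := by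
  rw [L2.inner_def]
  refine integral_congr_ae ?_
  filter_upwards [(memLp_phaseShift u q p).coeFn_toLp] with x hx
  have hx' : phaseShiftL2 u q p x = phaseShift u q p x := hx
  rw [hx', RCLike.inner_apply, mul_comm]

/-- The case `r = 2` makes the product with `ψ` integrable, the case `r = ⊤` keeps it in `L²`;
Plancherel below needs both. -/
theorem memLp_conj_shift (u : 𝓢(ℝ, ℂ)) (q : ℝ) (r : ENNReal) :
    MemLp (fun x => starRingEnd ℂ (u (x - q))) r (volume : Measure ℝ) :=
  ((compSubConstCLM ℂ q u).memLp r volume).star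

theorem integrable_conj_shift_mul (u : 𝓢(ℝ, ℂ)) (q : ℝ) (ψ : Lp ℂ 2 (volume : Measure ℝ)) :
    Integrable (fun x => starRingEnd ℂ (u (x - q)) * ψ x) :=
  (memLp_conj_shift u q 2).integrable_mul (Lp.memLp ψ)

theorem memLp_conj_shift_mul (u : 𝓢(ℝ, ℂ)) (q : ℝ) (ψ : Lp ℂ 2 (volume : Measure ℝ)) :
    MemLp (fun x => starRingEnd ℂ (u (x - q)) * ψ x) 2 volume :=
  (Lp.memLp ψ).mul (memLp_conj_shift u q ⊤)

open FourierTransform in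
theorem inner_phaseShiftL2_eq_fourier (u : 𝓢(ℝ, ℂ)) (q p : ℝ)
    (ψ : Lp ℂ 2 (volume : Measure ℝ)) :
    inner ℂ (phaseShiftL2 u q p) ψ =
      𝓕 (fun x => starRingEnd ℂ (u (x - q)) * ψ x) ((2 * Real.pi)⁻¹ * p) := by
  rw [inner_phaseShiftL2, Real.fourier_real_eq_integral_exp_smul]
  refine integral_congr_ae (Filter.Eventually.of_forall fun x => ?_)
  simp only [phaseShift, map_mul, smul_eq_mul, ← Complex.exp_conj, Complex.conj_I,
    Complex.conj_ofReal, mul_assoc]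
  congr 2
  push_cast
  have : (Real.pi : ℂ) ≠ 0 := by exact_mod_cast Real.pi_ne_zero
  field_simp

/-- Plancherel at fixed `q`; the factor `2π` comes from the frequency being `p / 2π`. -/
theorem lintegral_sq_inner_phaseShiftL2_momentum (u : 𝓢(ℝ, ℂ)) (q : ℝ)
    (ψ : Lp ℂ 2 (volume : Measure ℝ)) :
    ∫⁻ p, ‖inner ℂ (phaseShiftL2 u q p) ψ‖ₑ ^ 2 =
      ENNReal.ofReal (2 * Real.pi) * ∫⁻ x, ‖u (x - q)‖ₑ ^ 2 * ‖ψ x‖ₑ ^ 2 := by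
  have h1 := integrable_conj_shift_mul u q ψ
  have hpi : (0 : ℝ) < (2 * Real.pi)⁻¹ := by positivity
  have hm := (continuous_fourier_of_integrable h1).measurable
  have h2 := lintegral_sq_fourier h1 (memLp_conj_shift_mul u q ψ)
  rw [lintegral_comp_mul_left (by fun_prop) hpi.ne', abs_of_pos hpi] at h2
  simp only [← inner_phaseShiftL2_eq_fourier, enorm_mul, mul_pow, RCLike.enorm_conj] at h2
  rw [← h2, ← mul_assoc, ← ENNReal.ofReal_mul (by positivity), mul_inv_cancel₀ (by positivity),
    ENNReal.ofReal_one, one_mul]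

/-- After Tonelli the integral of `|u(x - q)|²` over `q` does not depend on `x`, so the double
integral factorizes. -/
theorem lintegral_sq_inner_phaseShiftL2 (u : 𝓢(ℝ, ℂ)) (ψ : Lp ℂ 2 (volume : Measure ℝ)) :
    ∫⁻ q, ∫⁻ p, ‖inner ℂ (phaseShiftL2 u q p) ψ‖ₑ ^ 2 =
      ENNReal.ofReal (2 * Real.pi) * ((∫⁻ x, ‖u x‖ₑ ^ 2) * ∫⁻ x, ‖ψ x‖ₑ ^ 2) := by
  have hψ : Measurable (ψ : ℝ → ℂ) := (Lp.stronglyMeasurable ψ).measurable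
  have hu : Measurable u := u.continuous.measurable
  simp only [lintegral_sq_inner_phaseShiftL2_momentum]
  rw [lintegral_const_mul' _ _ ENNReal.ofReal_ne_top, lintegral_lintegral_swap (by fun_prop)]
  congr 1
  rw [← lintegral_const_mul _ (by fun_prop)]
  refine lintegral_congr fun x => ?_
  rw [lintegral_mul_const _ (by fun_prop)]
  congr 1
  exact lintegral_sub_left_eq_self (fun y => ‖u y‖ₑ ^ 2) x

theorem lintegral_sq_coe_Lp {α : Type*} [MeasurableSpace α] {μ : Measure α} (ψ : Lp ℂ 2 μ) :
    ∫⁻ x, ‖ψ x‖ₑ ^ 2 ∂μ = ENNReal.ofReal (‖ψ‖ ^ 2) := by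
  have e := eLpNorm_nnreal_pow_eq_lintegral (f := ψ) (μ := μ) (p := 2) (by norm_num)
  simp only [ENNReal.coe_ofNat, NNReal.coe_ofNat, ENNReal.rpow_ofNat] at e
  rw [← e, ← Lp.enorm_def, ← ofReal_norm, ENNReal.ofReal_pow (norm_nonneg _)]

theorem lintegral_sq_coherentState (σ : ℝ) (hσ : 0 < σ) :
    ∫⁻ x, ‖coherentState σ hσ x‖ₑ ^ 2 = 1 := by
  have h0 : 0 < 2 * Real.pi * σ ^ 2 := by positivity
  have hb : 0 < 1 / (2 * σ ^ 2) := by positivity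
  have h1 : ∀ x, ‖coherentState σ hσ x‖ₑ ^ 2 =
      ENNReal.ofReal ((Real.sqrt (2 * Real.pi * σ ^ 2))⁻¹ * Real.exp (-(1 / (2 * σ ^ 2)) * x ^ 2)) := by
    intro x
    rw [coherentState_apply, ← ofReal_norm, ← ENNReal.ofReal_pow (norm_nonneg _),
      Complex.norm_real, Real.norm_eq_abs, sq_abs, mul_pow, ← Real.exp_nat_mul, div_pow, one_pow,
      ← Real.rpow_mul_natCast h0.le, Real.sqrt_eq_rpow, one_div]
    congr 3
    · norm_num
    · push_cast
      field_simp
      ring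
  simp only [h1]
  rw [← ofReal_integral_eq_lintegral_ofReal ((integrable_exp_neg_mul_sq hb).const_mul _)
    (Filter.Eventually.of_forall fun x => by positivity), integral_const_mul, integral_gaussian]
  have : Real.pi / (1 / (2 * σ ^ 2)) = 2 * Real.pi * σ ^ 2 := by field_simp
  rw [this, inv_mul_cancel₀ (Real.sqrt_pos.2 h0).ne', ENNReal.ofReal_one]

/-! ### The integral transform onto entire functions -/

/-- The integral kernel `(2πσ²)^(-1/4) exp(-z²/2 + xz/σ - x²/(4σ²))`. -/
noncomputable def bargmannKernel (σ : ℝ) (z : ℂ) (x : ℝ) : ℂ :=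
  ((1 / (2 * Real.pi * σ ^ 2) ^ (1 / 4 : ℝ) : ℝ) : ℂ) *
    Complex.exp (-z ^ 2 / 2 + x * z / σ - x ^ 2 / (4 * σ ^ 2))

/-- The integral transform with kernel `bargmannKernel`. -/
noncomputable def bargmannTransform (σ : ℝ) (ψ : ℝ → ℂ) (z : ℂ) : ℂ :=
  ∫ x, bargmannKernel σ z x * ψ x

theorem norm_phasePoint_sq (σ q p : ℝ) :
    ‖phasePoint σ q p‖ ^ 2 = q ^ 2 / (4 * σ ^ 2) + σ ^ 2 * p ^ 2 := by
  have h : phasePoint σ q p = ⟨q / (2 * σ), -(σ * p)⟩ := by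
    rw [Complex.mk_eq_add_mul_I, phasePoint]
    push_cast
    ring
  rw [h, Complex.sq_norm, Complex.normSq_mk, div_mul_div_comm]
  ring

/-- Both sides are Gaussians with the same prefactor. With `z = q/(2σ) - iσp`, the terms `|z|²/2 +
iqp/2 - q²/(4σ²)` combine to `-z²/2`, and `-ipx + xq/(2σ²)` is `xz/σ`; the conjugate of `z`
disappears. -/
theorem exp_mul_conj_phaseShift (σ : ℝ) (hσ : 0 < σ) (q p x : ℝ) :
    Real.exp (‖phasePoint σ q p‖ ^ 2 / 2) * Complex.exp (Complex.I * (q * p / 2)) *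
      starRingEnd ℂ (phaseShift (coherentState σ hσ) q p x) =
        bargmannKernel σ (phasePoint σ q p) x := by
  have hσ' : (σ : ℂ) ≠ 0 := by exact_mod_cast hσ.ne'
  rw [norm_phasePoint_sq, phaseShift, coherentState_apply, bargmannKernel, map_mul,
    Complex.conj_ofReal, ← Complex.exp_conj]
  simp only [Complex.ofReal_mul, Complex.ofReal_exp, map_mul, Complex.conj_I, Complex.conj_ofReal]
  have h : ∀ a b c d e : ℂ, Complex.exp a * Complex.exp b * (Complex.exp c * (e * Complex.exp d)) =
      e * Complex.exp (a + b + c + d) := fun a b c d e => by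
    simp only [Complex.exp_add]
    ring
  rw [h]
  congr 2
  rw [phasePoint]
  push_cast
  field_simp
  ring_nf
  simp only [Complex.I_sq]
  ring

theorem bargmannTransform_phasePoint (σ : ℝ) (hσ : 0 < σ) (ψ : Lp ℂ 2 (volume : Measure ℝ))
    (q p : ℝ) :
    bargmannTransform σ ψ (phasePoint σ q p) =
      Real.exp (‖phasePoint σ q p‖ ^ 2 / 2) * Complex.exp (Complex.I * (q * p / 2)) *
        inner ℂ (phaseShiftL2 (coherentState σ hσ) q p) ψ := by
  rw [inner_phaseShiftL2, ← integral_const_mul, bargmannTransform]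
  refine integral_congr_ae (Filter.Eventually.of_forall fun x => ?_)
  simp only [← exp_mul_conj_phaseShift σ hσ]
  ring

theorem integrable_gaussian_mul (b : ℝ) (hb : 0 < b) (ψ : Lp ℂ 2 (volume : Measure ℝ)) :
    Integrable fun x => Real.exp (-b * x ^ 2) * ‖ψ x‖ := by
  have h : MemLp (fun x => Real.exp (-b * x ^ 2)) 2 (volume : Measure ℝ) := by
    convert (realGaussian b 1 hb).memLp 2 volume using 1
    funext x
    exact (one_mul _).symm
  exact h.integrable_mul (Lp.memLp ψ).norm

theorem norm_bargmannKernel (σ : ℝ) (z : ℂ) (x : ℝ) :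
    ‖bargmannKernel σ z x‖ = |1 / (2 * Real.pi * σ ^ 2) ^ (1 / 4 : ℝ)| *
      Real.exp ((-z ^ 2 / 2).re + x * z.re / σ - x ^ 2 / (4 * σ ^ 2)) := by
  rw [bargmannKernel, norm_mul, Complex.norm_real, Real.norm_eq_abs, Complex.norm_exp]
  congr 2
  have h1 : ((x : ℂ) * z / σ).re = x * z.re / σ := by
    rw [Complex.div_ofReal_re, Complex.re_ofReal_mul]
  have h2 : ((x : ℂ) ^ 2 / (4 * σ ^ 2)).re = x ^ 2 / (4 * σ ^ 2) := by
    have : (x : ℂ) ^ 2 / (4 * σ ^ 2) = ((x ^ 2 / (4 * σ ^ 2) : ℝ) : ℂ) := by push_cast; rfl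
    rw [this, Complex.ofReal_re]
  rw [Complex.sub_re, Complex.add_re, h1, h2]

/-- A locally uniform Gaussian bound for the kernel and its derivative. -/
theorem exists_norm_bargmannKernel_mul_le (σ : ℝ) (hσ : 0 < σ) (R : ℝ) :
    ∃ C : ℝ, ∀ (z : ℂ) (x : ℝ), ‖z‖ ≤ R →
      ‖bargmannKernel σ z x‖ * (1 + R + |x| / σ) ≤
        C * Real.exp (-(1 / (8 * σ ^ 2)) * x ^ 2) := by
  -- With `t = |x|/σ`, the polynomial factor is at most `exp(R + t)` and the kernel exponent at most
  -- `R²/2 + Rt - t²/4`. Half of the Gaussian decay absorbs the linear term: `(R+1)t - t²/8 ≤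
  -- 2(R+1)²`.
  refine ⟨|1 / (2 * Real.pi * σ ^ 2) ^ (1 / 4 : ℝ)| *
    Real.exp (R ^ 2 / 2 + R + 2 * (R + 1) ^ 2), fun z x hz => ?_⟩
  rw [norm_bargmannKernel, mul_assoc |1 / (2 * Real.pi * σ ^ 2) ^ (1 / 4 : ℝ)|,
    mul_assoc |1 / (2 * Real.pi * σ ^ 2) ^ (1 / 4 : ℝ)|, ← Real.exp_add]
  refine mul_le_mul_of_nonneg_left ?_ (abs_nonneg _)
  have h1 : 1 + R + |x| / σ ≤ Real.exp (R + |x| / σ) := by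
    linarith [Real.add_one_le_exp (R + |x| / σ)]
  refine (mul_le_mul_of_nonneg_left h1 (Real.exp_pos _).le).trans ?_
  rw [← Real.exp_add, Real.exp_le_exp]
  have h2 : (-z ^ 2 / 2).re ≤ R ^ 2 / 2 := by
    refine (Complex.re_le_norm _).trans ?_
    rw [norm_div, norm_neg, norm_pow, Complex.norm_ofNat]
    gcongr
  have h3 : x * z.re / σ ≤ R * (|x| / σ) := by
    rw [← mul_div_assoc]
    refine div_le_div_of_nonneg_right ?_ hσ.le
    refine (le_abs_self _).trans ?_
    rw [abs_mul, mul_comm]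
    exact mul_le_mul_of_nonneg_right ((Complex.abs_re_le_norm z).trans hz) (abs_nonneg _)
  have h4 : x ^ 2 / (4 * σ ^ 2) = (|x| / σ) ^ 2 / 4 := by
    rw [div_pow, sq_abs]
    field_simp
  have h5 : 1 / (8 * σ ^ 2) * x ^ 2 = (|x| / σ) ^ 2 / 8 := by
    rw [div_pow, sq_abs]
    field_simp
  rw [neg_mul, h4, h5]
  nlinarith [sq_nonneg (|x| / σ - 4 * (R + 1))]

theorem continuous_bargmannKernel (σ : ℝ) (z : ℂ) : Continuous (bargmannKernel σ z) := by
  unfold bargmannKernel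
  fun_prop

theorem integrable_bargmannKernel_mul (σ : ℝ) (hσ : 0 < σ) (z : ℂ)
    (ψ : Lp ℂ 2 (volume : Measure ℝ)) : Integrable fun x => bargmannKernel σ z x * ψ x := by
  obtain ⟨C, hC⟩ := exists_norm_bargmannKernel_mul_le σ hσ ‖z‖
  refine Integrable.mono' ((integrable_gaussian_mul _ (by positivity : 0 < 1 / (8 * σ ^ 2))
    ψ).const_mul C) ((continuous_bargmannKernel σ z).aestronglyMeasurable.mul
      (Lp.aestronglyMeasurable ψ)) (Filter.Eventually.of_forall fun x => ?_)
  rw [norm_mul, ← mul_assoc]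
  refine mul_le_mul_of_nonneg_right (le_trans ?_ (hC z x le_rfl)) (norm_nonneg _)
  refine le_mul_of_one_le_right (norm_nonneg _) ?_
  have : 0 ≤ |x| / σ := by positivity
  linarith [norm_nonneg z]

theorem hasDerivAt_bargmannKernel (σ : ℝ) (z : ℂ) (x : ℝ) :
    HasDerivAt (fun z => bargmannKernel σ z x) (bargmannKernel σ z x * (-z + x / σ)) z := by
  have h : HasDerivAt (fun z : ℂ => -z ^ 2 / 2 + x * z / σ - x ^ 2 / (4 * σ ^ 2))
      (-z + x / σ) z := by
    have := ((((hasDerivAt_id z).pow 2).neg.div_const 2).add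
      (((hasDerivAt_id z).const_mul (x : ℂ)).div_const (σ : ℂ))).sub_const
        ((x : ℂ) ^ 2 / (4 * σ ^ 2))
    refine this.congr_deriv ?_
    simp only [id]
    push_cast
    ring
  exact (h.cexp.const_mul _).congr_deriv (mul_assoc _ _ _).symm

theorem differentiable_bargmannTransform (σ : ℝ) (hσ : 0 < σ) (ψ : Lp ℂ 2 (volume : Measure ℝ)) :
    Differentiable ℂ (bargmannTransform σ ψ) := by
  intro z
  set R := ‖z‖ + 1 with hR
  obtain ⟨C, hC⟩ := exists_norm_bargmannKernel_mul_le σ hσ R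
  have hmem : Metric.ball (0 : ℂ) R ∈ nhds z := Metric.isOpen_ball.mem_nhds (by simp [hR])
  refine (hasDerivAt_integral_of_dominated_loc_of_deriv_le (μ := volume)
    (F := fun z x => bargmannKernel σ z x * ψ x)
    (F' := fun z x => bargmannKernel σ z x * (-z + x / σ) * ψ x)
    (bound := fun x => C * (Real.exp (-(1 / (8 * σ ^ 2)) * x ^ 2) * ‖ψ x‖)) hmem
    (Filter.Eventually.of_forall fun w => (integrable_bargmannKernel_mul σ hσ w ψ).1)
    (integrable_bargmannKernel_mul σ hσ z ψ) ?_ (Filter.Eventually.of_forall fun x w hw => ?_)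
    ((integrable_gaussian_mul _ (by positivity) ψ).const_mul C)
    (Filter.Eventually.of_forall fun x w _ => ?_)).2.differentiableAt
  · refine Continuous.aestronglyMeasurable ?_ |>.mul (Lp.aestronglyMeasurable ψ)
    have := continuous_bargmannKernel σ z
    fun_prop
  · have hw' : ‖w‖ ≤ R := (mem_ball_zero_iff.1 hw).le
    rw [norm_mul, norm_mul, ← mul_assoc]
    refine mul_le_mul_of_nonneg_right (le_trans ?_ (hC w x hw')) (norm_nonneg _)
    refine mul_le_mul_of_nonneg_left ?_ (norm_nonneg _)
    refine (norm_add_le _ _).trans ?_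
    rw [norm_neg, norm_div, Complex.norm_real, Complex.norm_real, Real.norm_eq_abs,
      Real.norm_of_nonneg hσ.le]
    linarith
  · exact (hasDerivAt_bargmannKernel σ w x).mul_const _

/-! ### The isometries -/

/-- Solved for `Vψ`, the relation exhibits it as smooth factors times an entire function of `z`;
this is the source of its smoothness. -/
theorem phaseSpaceFunction_eq_bargmannTransform (σ : ℝ) (hσ : 0 < σ)
    (ψ : Lp ℂ 2 (volume : Measure ℝ)) :
    phaseSpaceFunction (coherentState σ hσ) ψ = fun x =>
      (1 / Real.sqrt (2 * Real.pi) : ℝ) * (Complex.exp (-(((x.1 ^ 2 / (4 * σ ^ 2) +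
        σ ^ 2 * x.2 ^ 2) / 2 : ℝ) : ℂ)) * Complex.exp (-(Complex.I * (x.1 * x.2 / 2))) *
          bargmannTransform σ ψ (phasePoint σ x.1 x.2)) := by
  funext x
  rw [phaseSpaceFunction, bargmannTransform_phasePoint σ hσ, norm_phasePoint_sq,
    Complex.ofReal_exp]
  congr 1
  simp only [Complex.exp_neg]
  have h1 := Complex.exp_ne_zero (((x.1 ^ 2 / (4 * σ ^ 2) + σ ^ 2 * x.2 ^ 2) / 2 : ℝ) : ℂ)
  have h2 := Complex.exp_ne_zero (Complex.I * (x.1 * x.2 / 2))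
  field_simp

theorem contDiff_phaseSpaceFunction (σ : ℝ) (hσ : 0 < σ) (ψ : Lp ℂ 2 (volume : Measure ℝ))
    {n : WithTop ℕ∞} : ContDiff ℝ n (phaseSpaceFunction (coherentState σ hσ) ψ) := by
  rw [phaseSpaceFunction_eq_bargmannTransform]
  have h0 : ContDiff ℝ n (bargmannTransform σ ψ) :=
    (differentiable_bargmannTransform σ hσ ψ).contDiff.restrict_scalars ℝ
  have hc : ContDiff ℝ n (fun t : ℝ => (t : ℂ)) := Complex.ofRealCLM.contDiff
  have h1 : ContDiff ℝ n fun x : ℝ × ℝ => (x.1 : ℂ) := hc.comp contDiff_fst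
  have h2 : ContDiff ℝ n fun x : ℝ × ℝ => (x.2 : ℂ) := hc.comp contDiff_snd
  have h3 : ContDiff ℝ n fun x : ℝ × ℝ => phasePoint σ x.1 x.2 := by
    unfold phasePoint
    fun_prop
  have h4 : ContDiff ℝ n fun x : ℝ × ℝ =>
      (((x.1 ^ 2 / (4 * σ ^ 2) + σ ^ 2 * x.2 ^ 2) / 2 : ℝ) : ℂ) := hc.comp (by fun_prop)
  have h5 := h0.comp h3
  simp only [Function.comp_def] at h5
  fun_prop

theorem lintegral_sq_phaseSpaceFunction (σ : ℝ) (hσ : 0 < σ) (ψ : Lp ℂ 2 (volume : Measure ℝ)) :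
    ∫⁻ x, ‖phaseSpaceFunction (coherentState σ hσ) ψ x‖ₑ ^ 2 = ENNReal.ofReal (‖ψ‖ ^ 2) := by
  have hm : Measurable (phaseSpaceFunction (coherentState σ hσ) ψ) :=
    (contDiff_phaseSpaceFunction σ hσ ψ (n := 0)).continuous.measurable
  have h1 : 0 < 2 * Real.pi := by positivity
  have h2 : ‖((1 / Real.sqrt (2 * Real.pi) : ℝ) : ℂ)‖ₑ ^ 2 =
      ENNReal.ofReal (2 * Real.pi)⁻¹ := by
    rw [← ofReal_norm, ← ENNReal.ofReal_pow (norm_nonneg _), Complex.norm_real, Real.norm_eq_abs,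
      sq_abs, div_pow, Real.sq_sqrt h1.le, one_pow, one_div]
  rw [Measure.volume_eq_prod, lintegral_prod _ (by fun_prop)]
  simp only [phaseSpaceFunction, enorm_mul, mul_pow, h2]
  simp only [lintegral_const_mul' _ _ ENNReal.ofReal_ne_top]
  rw [lintegral_sq_inner_phaseShiftL2, lintegral_sq_coherentState, one_mul,
    lintegral_sq_coe_Lp, ← mul_assoc, ← ENNReal.ofReal_mul (by positivity),
    inv_mul_cancel₀ h1.ne', ENNReal.ofReal_one, one_mul]

theorem memLp_two_of_lintegral_sq {α : Type*} [MeasurableSpace α] {μ : Measure α} {f : α → ℂ}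
    (hf : AEStronglyMeasurable f μ) (h : ∫⁻ x, ‖f x‖ₑ ^ 2 ∂μ ≠ ⊤) : MemLp f 2 μ := by
  refine ⟨hf, (eLpNorm_lt_top_iff_lintegral_rpow_enorm_lt_top (by norm_num) (by norm_num)).2 ?_⟩
  simpa using h.lt_top

theorem memLp_phaseSpaceFunction (σ : ℝ) (hσ : 0 < σ) (ψ : Lp ℂ 2 (volume : Measure ℝ)) :
    MemLp (phaseSpaceFunction (coherentState σ hσ) ψ) 2 volume := by
  refine memLp_two_of_lintegral_sq
    (contDiff_phaseSpaceFunction σ hσ ψ (n := 0)).continuous.aestronglyMeasurable ?_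
  rw [lintegral_sq_phaseSpaceFunction]
  exact ENNReal.ofReal_ne_top

/-- The isometry `ψ ↦ Vψ` of `L²(ℝ)` into `L²(ℝ²)`. -/
noncomputable def phaseSpaceIsometry (σ : ℝ) (hσ : 0 < σ) :
    Lp ℂ 2 (volume : Measure ℝ) →ₗᵢ[ℂ] Lp ℂ 2 (volume : Measure (ℝ × ℝ)) where
  toFun ψ := (memLp_phaseSpaceFunction σ hσ ψ).toLp _
  map_add' ψ χ := by
    rw [← MemLp.toLp_add]
    congr 1
    funext x
    simp [phaseSpaceFunction, inner_add_right, mul_add]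
  map_smul' c ψ := by
    rw [RingHom.id_apply, ← MemLp.toLp_const_smul]
    congr 1
    funext x
    simp [phaseSpaceFunction, inner_smul_right, mul_left_comm]
  norm_map' ψ := by
    have h := lintegral_sq_coe_Lp ((memLp_phaseSpaceFunction σ hσ ψ).toLp _)
    rw [lintegral_congr_ae (g := fun x => ‖phaseSpaceFunction (coherentState σ hσ) ψ x‖ₑ ^ 2),
      lintegral_sq_phaseSpaceFunction, ENNReal.ofReal_eq_ofReal_iff (by positivity)
        (by positivity)] at h
    · exact ((sq_eq_sq₀ (norm_nonneg _) (norm_nonneg _)).1 h).symm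
    · filter_upwards [(memLp_phaseSpaceFunction σ hσ ψ).coeFn_toLp] with x hx
      rw [hx]

theorem phaseSpaceIsometry_coeFn (σ : ℝ) (hσ : 0 < σ) (ψ : Lp ℂ 2 (volume : Measure ℝ)) :
    phaseSpaceIsometry σ hσ ψ =ᵐ[volume] phaseSpaceFunction (coherentState σ hσ) ψ :=
  (memLp_phaseSpaceFunction σ hσ ψ).coeFn_toLp

/-- The coordinates of `z` are `q/(2σ)` and `-σp`, so the Jacobian is `(1/(2σ)) · σ = 1/2`. -/
theorem lintegral_phasePoint (σ : ℝ) (hσ : 0 < σ) {G : ℂ → ENNReal} (hG : Measurable G) :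
    ∫⁻ z, G z = ENNReal.ofReal (1 / 2) * ∫⁻ q, ∫⁻ p, G (phasePoint σ q p) := by
  have h1 : (0 : ℝ) < (2 * σ)⁻¹ := by positivity
  have hm : Measurable fun x : ℝ × ℝ => G (Complex.measurableEquivRealProd.symm x) :=
    hG.comp Complex.measurableEquivRealProd.symm.measurable
  rw [← (Complex.volume_preserving_equiv_real_prod.symm).lintegral_comp hG,
    Measure.volume_eq_prod, lintegral_prod _ hm.aemeasurable,
    lintegral_comp_mul_left hm.lintegral_prod_right' h1.ne', abs_of_pos h1]
  have h2 : ∀ q : ℝ, ∫⁻ y, G (Complex.measurableEquivRealProd.symm ((2 * σ)⁻¹ * q, y)) =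
      ENNReal.ofReal σ * ∫⁻ p, G (phasePoint σ q p) := by
    intro q
    have hm' : Measurable fun y : ℝ =>
      G (Complex.measurableEquivRealProd.symm ((2 * σ)⁻¹ * q, y)) := hm.comp measurable_prodMk_left
    rw [lintegral_comp_mul_left hm' (neg_ne_zero.2 hσ.ne'), abs_neg, abs_of_pos hσ]
    congr 1
    refine lintegral_congr fun p => congrArg G ?_
    rw [Complex.measurableEquivRealProd_symm_apply, Complex.mk_eq_add_mul_I, phasePoint]
    push_cast
    rw [mul_inv]
    ring
  simp only [h2]
  rw [lintegral_const_mul' _ _ ENNReal.ofReal_ne_top, ← mul_assoc,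
    ← ENNReal.ofReal_mul h1.le]
  congr 2
  field_simp

theorem lintegral_sq_bargmannTransform (σ : ℝ) (hσ : 0 < σ) (ψ : Lp ℂ 2 (volume : Measure ℝ)) :
    ∫⁻ z, ‖bargmannTransform σ ψ z‖ₑ ^ 2 ∂bargmannMeasure = ENNReal.ofReal (‖ψ‖ ^ 2) := by
  have hc := (differentiable_bargmannTransform σ hσ ψ).continuous
  rw [lintegral_bargmannMeasure _ (by fun_prop), lintegral_phasePoint σ hσ (by fun_prop)]
  have h1 : ∀ q p : ℝ, ENNReal.ofReal (Real.pi⁻¹ * Real.exp (-‖phasePoint σ q p‖ ^ 2)) *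
      ‖bargmannTransform σ ψ (phasePoint σ q p)‖ₑ ^ 2 =
        ENNReal.ofReal Real.pi⁻¹ *
          ‖inner ℂ (phaseShiftL2 (coherentState σ hσ) q p) ψ‖ₑ ^ 2 := by
    intro q p
    rw [bargmannTransform_phasePoint σ hσ]
    simp only [← ofReal_norm, ← ENNReal.ofReal_pow (norm_nonneg _)]
    rw [← ENNReal.ofReal_mul (by positivity), ← ENNReal.ofReal_mul (by positivity)]
    congr 1
    have h2 : ‖Complex.exp (Complex.I * (q * p / 2))‖ = 1 := by
      have := Complex.norm_exp_ofReal_mul_I (q * p / 2)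
      push_cast at this
      rwa [mul_comm] at this
    rw [norm_mul, norm_mul, h2, Complex.norm_real, Real.norm_of_nonneg (Real.exp_pos _).le,
      mul_one, mul_pow, ← Real.exp_nat_mul, mul_assoc, ← mul_assoc (Real.exp _), ← Real.exp_add]
    have h3 : -‖phasePoint σ q p‖ ^ 2 + ((2 : ℕ) : ℝ) * (‖phasePoint σ q p‖ ^ 2 / 2) = 0 := by
      push_cast
      ring
    rw [h3, Real.exp_zero, one_mul]
  simp only [h1, lintegral_const_mul' _ _ ENNReal.ofReal_ne_top]
  rw [lintegral_sq_inner_phaseShiftL2, lintegral_sq_coherentState, one_mul,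
    lintegral_sq_coe_Lp, ← mul_assoc, ← mul_assoc, ← ENNReal.ofReal_mul (by positivity),
    ← ENNReal.ofReal_mul (by positivity)]
  -- The Jacobian, the normalization of the measure and the Plancherel factor cancel.
  have h4 : 1 / 2 * Real.pi⁻¹ * (2 * Real.pi) = 1 := by
    have := Real.pi_ne_zero
    field_simp
  rw [h4, ENNReal.ofReal_one, one_mul]

/-- The integral transform of a square-integrable function, as a square-integrable entire
function. -/
noncomputable def bargmannTransformₗ (σ : ℝ) (hσ : 0 < σ) :
    Lp ℂ 2 (volume : Measure ℝ) →ₗ[ℂ] bargmannFunctions where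
  toFun ψ := ⟨bargmannTransform σ ψ, differentiable_bargmannTransform σ hσ ψ, by
    have hc := (differentiable_bargmannTransform σ hσ ψ).continuous
    refine (memLp_bargmannMeasure_iff hc).1
      (memLp_two_of_lintegral_sq hc.aestronglyMeasurable ?_)
    rw [lintegral_sq_bargmannTransform σ hσ]
    exact ENNReal.ofReal_ne_top⟩
  map_add' ψ χ := by
    ext z
    refine Eq.trans ?_ (integral_add (integrable_bargmannKernel_mul σ hσ z ψ)
      (integrable_bargmannKernel_mul σ hσ z χ))
    refine integral_congr_ae ?_
    filter_upwards [Lp.coeFn_add ψ χ] with x hx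
    rw [hx, Pi.add_apply, mul_add]
  map_smul' c ψ := by
    ext z
    refine Eq.trans ?_ (integral_const_mul c _)
    refine integral_congr_ae ?_
    filter_upwards [Lp.coeFn_smul c ψ] with x hx
    rw [hx, Pi.smul_apply, smul_eq_mul, mul_left_comm]

theorem bargmannTransformₗ_apply (σ : ℝ) (hσ : 0 < σ) (ψ : Lp ℂ 2 (volume : Measure ℝ)) (z : ℂ) :
    (bargmannTransformₗ σ hσ ψ).1 z = bargmannTransform σ ψ z := rfl

/-- The isometry `L²(ℝ) → bargmannSpace` given by the integral transform. -/
noncomputable def bargmannTransformIsometry (σ : ℝ) (hσ : 0 < σ) :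
    Lp ℂ 2 (volume : Measure ℝ) →ₗᵢ[ℂ] bargmannSpace where
  toLinearMap := bargmannToL2.rangeRestrict ∘ₗ bargmannTransformₗ σ hσ
  norm_map' ψ := by
    have h := norm_sq_bargmannToL2_eq_lintegral (bargmannTransformₗ σ hσ ψ)
    simp only [bargmannTransformₗ_apply] at h
    rw [lintegral_sq_bargmannTransform σ hσ,
      ENNReal.ofReal_eq_ofReal_iff (by positivity) (by positivity)] at h
    exact (sq_eq_sq₀ (norm_nonneg _) (norm_nonneg _)).1 h

theorem bargmannTransformIsometry_apply (σ : ℝ) (hσ : 0 < σ)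
    (ψ : Lp ℂ 2 (volume : Measure ℝ)) :
    bargmannTransformIsometry σ hσ ψ = bargmannClass (bargmannTransformₗ σ hσ ψ) := rfl

/-! ### The harmonic oscillator -/

theorem momentumOp_apply (f : 𝓢(ℝ, ℂ)) (x : ℝ) : momentumOp f x = -Complex.I * deriv f x := by
  simp [momentumOp, derivCLM_apply]

/-- The canonical commutation relation `PQ = QP - i`. -/
theorem momentumOp_positionOp (f : 𝓢(ℝ, ℂ)) :
    momentumOp (positionOp f) = positionOp (momentumOp f) - Complex.I • f := by
  ext x
  have h : (positionOp f : ℝ → ℂ) = fun x : ℝ => (x : ℂ) * f x := funext (positionOp_apply f)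
  have hd : HasDerivAt (fun x : ℝ => (x : ℂ) * f x) (1 * f x + x * deriv f x) x :=
    (Complex.ofRealCLM.hasDerivAt (x := x)).mul f.differentiableAt.hasDerivAt
  rw [momentumOp_apply, h, hd.deriv, sub_apply, positionOp_apply, momentumOp_apply, smul_apply,
    smul_eq_mul]
  ring

theorem sqrt_mul_eq (m ω σ : ℝ) (hσ : 0 < σ) (h : m * ω = 1 / (2 * σ ^ 2)) :
    Real.sqrt (m * ω) = 1 / (Real.sqrt 2 * σ) := by
  rw [h, Real.sqrt_div zero_le_one, Real.sqrt_one, Real.sqrt_mul zero_le_two,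
    Real.sqrt_sq hσ.le]

theorem one_div_sqrt_two_mul_eq (m ω σ : ℝ) (hσ : 0 < σ) (h : m * ω = 1 / (2 * σ ^ 2)) :
    1 / Real.sqrt (2 * m * ω) = σ := by
  have h1 : 2 * m * ω = (1 / σ) ^ 2 := by
    rw [mul_assoc, h]
    field_simp
  rw [h1, Real.sqrt_sq (by positivity), one_div_one_div]

/-- Expressed through `σ`, the coefficients lose their square roots, and the operator identities
below become rational. -/
theorem creationOp_eq (m ω σ : ℝ) (hσ : 0 < σ) (h : m * ω = 1 / (2 * σ ^ 2)) (f : 𝓢(ℝ, ℂ)) :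
    creationOp m ω f =
      (1 / (2 * σ) : ℂ) • positionOp f - (Complex.I * σ) • momentumOp f := by
  have h2 : ((Real.sqrt 2 : ℝ) : ℂ) ≠ 0 := by
    exact_mod_cast (Real.sqrt_pos.2 (zero_lt_two (α := ℝ))).ne'
  have h3 : ((Real.sqrt 2 : ℝ) : ℂ) ^ 2 = 2 := by
    exact_mod_cast Real.sq_sqrt (zero_le_two (α := ℝ))
  have hs : (σ : ℂ) ≠ 0 := by exact_mod_cast hσ.ne'
  ext x
  simp only [creationOp, sqrt_mul_eq m ω σ hσ h, smul_apply, sub_apply, smul_eq_mul]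
  push_cast
  field_simp
  rw [h3]
  ring

theorem deriv_coherentState (σ : ℝ) (hσ : 0 < σ) (x : ℝ) :
    deriv (coherentState σ hσ) x = -(x / (2 * σ ^ 2)) * coherentState σ hσ x := by
  have h : (coherentState σ hσ : ℝ → ℂ) = fun x : ℝ =>
      ((1 / (2 * Real.pi * σ ^ 2) ^ (1 / 4 : ℝ) * Real.exp (-(x ^ 2 / (4 * σ ^ 2))) : ℝ) : ℂ) :=
    funext (coherentState_apply σ hσ)
  have h1 : HasDerivAt (fun x : ℝ => -(x ^ 2 / (4 * σ ^ 2))) (-(x / (2 * σ ^ 2))) x := by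
    refine ((((hasDerivAt_id x).pow 2).div_const (4 * σ ^ 2)).neg).congr_deriv ?_
    simp only [id]
    push_cast
    field_simp
    ring
  rw [h]
  refine ((h1.exp.const_mul (1 / (2 * Real.pi * σ ^ 2) ^ (1 / 4 : ℝ))).ofReal_comp).deriv.trans ?_
  push_cast
  ring

theorem momentumOp_coherentState (σ : ℝ) (hσ : 0 < σ) :
    momentumOp (coherentState σ hσ) =
      (Complex.I / (2 * σ ^ 2)) • positionOp (coherentState σ hσ) := by
  ext x
  rw [momentumOp_apply, deriv_coherentState, smul_apply, positionOp_apply, smul_eq_mul]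
  ring

theorem oscillatorHamiltonian_apply (m ω : ℝ) (f : 𝓢(ℝ, ℂ)) :
    oscillatorHamiltonian m ω f = ((1 / (2 * m) : ℝ) : ℂ) • momentumOp (momentumOp f) +
      ((m * ω ^ 2 / 2 : ℝ) : ℂ) • positionOp (positionOp f) := rfl

theorem oscillatorHamiltonian_coherentState (m ω σ : ℝ) (hm : 0 < m) (hσ : 0 < σ)
    (h : m * ω = 1 / (2 * σ ^ 2)) :
    oscillatorHamiltonian m ω (coherentState σ hσ) =
      ((ω / 2 : ℝ) : ℂ) • coherentState σ hσ := by
  have hm' : (m : ℂ) ≠ 0 := by exact_mod_cast hm.ne'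
  have hs : (σ : ℂ) ≠ 0 := by exact_mod_cast hσ.ne'
  have hω' : (ω : ℂ) = 1 / (2 * m * σ ^ 2) := by
    have : ω = 1 / (2 * m * σ ^ 2) := by
      field_simp at h ⊢
      linarith
    rw [this]
    push_cast
    rfl
  rw [oscillatorHamiltonian_apply, momentumOp_coherentState, map_smul, momentumOp_positionOp,
    momentumOp_coherentState, map_smul]
  ext x
  simp only [add_apply, sub_apply, smul_apply, smul_eq_mul]
  push_cast
  rw [hω']
  field_simp
  ring_nf
  simp only [Complex.I_sq]
  ring

/-- The ladder relation `Ha* = a*(H + ω)`. -/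
theorem oscillatorHamiltonian_creationOp (m ω σ : ℝ) (hm : 0 < m) (hσ : 0 < σ)
    (h : m * ω = 1 / (2 * σ ^ 2)) (f : 𝓢(ℝ, ℂ)) :
    oscillatorHamiltonian m ω (creationOp m ω f) =
      creationOp m ω (oscillatorHamiltonian m ω f) + (ω : ℂ) • creationOp m ω f := by
  have hm' : (m : ℂ) ≠ 0 := by exact_mod_cast hm.ne'
  have hs : (σ : ℂ) ≠ 0 := by exact_mod_cast hσ.ne'
  have hω' : (ω : ℂ) = 1 / (2 * m * σ ^ 2) := by
    have : ω = 1 / (2 * m * σ ^ 2) := by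
      field_simp at h ⊢
      linarith
    rw [this]
    push_cast
    rfl
  -- The commutation relation moves every `P` to the right of every `Q`; then only coefficients of
  -- ordered words remain to be compared.
  simp only [creationOp_eq m ω σ hσ h, oscillatorHamiltonian_apply, map_add, map_sub, map_smul,
    momentumOp_positionOp]
  ext x
  simp only [add_apply, sub_apply, smul_apply, smul_eq_mul]
  push_cast
  rw [hω']
  field_simp
  ring_nf
  simp only [Complex.I_sq]
  ring

theorem oscillatorEigenfunction_eq (m ω σ : ℝ) (hm : 0 < m) (hω : 0 < ω) (hσ : 0 < σ)
    (h : m * ω = 1 / (2 * σ ^ 2)) (n : ℕ) :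
    oscillatorEigenfunction m ω hm hω n = ((1 / Real.sqrt n.factorial : ℝ) : ℂ) •
      (creationOp m ω)^[n] (coherentState σ hσ) := by
  have h1 := one_div_sqrt_two_mul_eq m ω σ hσ h
  unfold oscillatorEigenfunction
  congr 3

theorem oscillatorHamiltonian_iterate (m ω σ : ℝ) (hm : 0 < m) (hσ : 0 < σ)
    (h : m * ω = 1 / (2 * σ ^ 2)) (n : ℕ) :
    oscillatorHamiltonian m ω ((creationOp m ω)^[n] (coherentState σ hσ)) =
      ((ω * (n + 1 / 2) : ℝ) : ℂ) • (creationOp m ω)^[n] (coherentState σ hσ) := by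
  induction n with
  | zero =>
    rw [Function.iterate_zero, id, oscillatorHamiltonian_coherentState m ω σ hm hσ h]
    congr 2
    push_cast
    ring
  | succ n ih =>
    rw [Function.iterate_succ_apply', oscillatorHamiltonian_creationOp m ω σ hm hσ h, ih, map_smul,
      ← add_smul]
    congr 1
    push_cast
    ring

theorem oscillatorHamiltonian_eigenfunction (m ω σ : ℝ) (hm : 0 < m) (hω : 0 < ω) (hσ : 0 < σ)
    (h : m * ω = 1 / (2 * σ ^ 2)) (n : ℕ) :
    oscillatorHamiltonian m ω (oscillatorEigenfunction m ω hm hω n) =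
      ((ω * (n + 1 / 2) : ℝ) : ℂ) • oscillatorEigenfunction m ω hm hω n := by
  rw [oscillatorEigenfunction_eq m ω σ hm hω hσ h, map_smul,
    oscillatorHamiltonian_iterate m ω σ hm hσ h, smul_comm]

/-! ### The transform of the energy eigenfunctions -/

theorem bargmannTransform_toLp (σ : ℝ) (f : 𝓢(ℝ, ℂ)) (z : ℂ) :
    bargmannTransform σ (f.toLp 2 volume) z = bargmannTransform σ f z := by
  refine integral_congr_ae ?_
  filter_upwards [f.coeFn_toLp 2 volume] with x hx
  rw [hx]

theorem integrable_bargmannKernel_mul_schwartz (σ : ℝ) (hσ : 0 < σ) (z : ℂ) (f : 𝓢(ℝ, ℂ)) :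
    Integrable fun x => bargmannKernel σ z x * f x := by
  refine (integrable_bargmannKernel_mul σ hσ z (f.toLp 2 volume)).congr ?_
  filter_upwards [f.coeFn_toLp 2 volume] with x hx
  rw [hx]

theorem bargmannTransform_smul (σ : ℝ) (c : ℂ) (f : ℝ → ℂ) (z : ℂ) :
    bargmannTransform σ (c • f) z = c * bargmannTransform σ f z := by
  rw [bargmannTransform, bargmannTransform, ← integral_const_mul]
  simp only [Pi.smul_apply, smul_eq_mul, mul_left_comm]

theorem hasDerivAt_bargmannKernel_right (σ : ℝ) (z : ℂ) (x : ℝ) :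
    HasDerivAt (bargmannKernel σ z) (bargmannKernel σ z x * (z / σ - x / (2 * σ ^ 2))) x := by
  have hx : HasDerivAt (fun x : ℝ => (x : ℂ)) 1 x := Complex.ofRealCLM.hasDerivAt
  have h : HasDerivAt (fun x : ℝ => -z ^ 2 / 2 + x * z / σ - (x : ℂ) ^ 2 / (4 * σ ^ 2))
      (z / σ - x / (2 * σ ^ 2)) x := by
    refine ((((hx.mul_const z).div_const (σ : ℂ)).const_add (-z ^ 2 / 2)).sub
      ((hx.pow 2).div_const (4 * (σ : ℂ) ^ 2))).congr_deriv ?_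
    push_cast
    ring
  exact (h.cexp.const_mul _).congr_deriv (mul_assoc _ _ _).symm

/-- The transform turns the creation operator into multiplication by `z`. -/
theorem bargmannTransform_creationOp (m ω σ : ℝ) (hσ : 0 < σ) (h : m * ω = 1 / (2 * σ ^ 2))
    (f : 𝓢(ℝ, ℂ)) (z : ℂ) :
    bargmannTransform σ (creationOp m ω f) z = z * bargmannTransform σ f z := by
  have hs : (σ : ℂ) ≠ 0 := by exact_mod_cast hσ.ne'
  have hK := fun g => integrable_bargmannKernel_mul_schwartz σ hσ z g
  have hd : (derivCLM ℂ ℂ f : ℝ → ℂ) = deriv f := funext fun x => derivCLM_apply ℂ f x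
  have h1 : Integrable fun x => bargmannKernel σ z x * deriv f x := by
    have := hK (derivCLM ℂ ℂ f)
    rwa [hd] at this
  have h2 : Integrable fun x => bargmannKernel σ z x * (x * f x) := by
    simpa only [positionOp_apply] using hK (positionOp f)
  have h3 : Integrable fun x : ℝ =>
      bargmannKernel σ z x * (z / σ - x / (2 * σ ^ 2)) * f x := by
    refine (((hK f).const_mul (z / σ)).sub (h2.const_mul (1 / (2 * (σ : ℂ) ^ 2)))).congr ?_
    refine Filter.Eventually.of_forall fun x => ?_
    simp only [Pi.sub_apply]
    ring
  -- Integration by parts moves the derivative of `f` to the kernel. In `σ (z/σ - x/(2σ²))` the `x`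
  -- term cancels the position part of `a*`, and `z` remains.
  have key := integral_mul_deriv_eq_deriv_mul_of_integrable
    (fun x _ => hasDerivAt_bargmannKernel_right σ z x)
    (fun x _ => f.differentiableAt.hasDerivAt) h1 h3 (hK f)
  have h4 : ∀ x : ℝ, creationOp m ω f x = 1 / (2 * σ) * (x * f x) - σ * deriv f x := by
    intro x
    rw [creationOp_eq m ω σ hσ h, sub_apply, smul_apply, smul_apply, positionOp_apply,
      momentumOp_apply, smul_eq_mul, smul_eq_mul]
    ring_nf
    simp only [Complex.I_sq]
    ring
  have h5 : bargmannTransform σ (creationOp m ω f) z =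
      1 / (2 * σ) * (∫ x, bargmannKernel σ z x * (x * f x)) -
        σ * ∫ x, bargmannKernel σ z x * deriv f x := by
    rw [← integral_const_mul, ← integral_const_mul,
      ← integral_sub (h2.const_mul _) (h1.const_mul _), bargmannTransform]
    refine integral_congr_ae (Filter.Eventually.of_forall fun x => ?_)
    simp only [h4]
    ring
  have h6 : ∫ x : ℝ, bargmannKernel σ z x * (z / σ - x / (2 * σ ^ 2)) * f x =
      z / σ * bargmannTransform σ f z -
        1 / (2 * (σ : ℂ) ^ 2) * ∫ x, bargmannKernel σ z x * (x * f x) := by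
    rw [bargmannTransform, ← integral_const_mul, ← integral_const_mul,
      ← integral_sub ((hK f).const_mul _) (h2.const_mul _)]
    refine integral_congr_ae (Filter.Eventually.of_forall fun x => ?_)
    simp only
    ring
  rw [h5, key, h6]
  field_simp
  ring

/-- Completing the square in `x` produces `exp(z²/2)`, which cancels the factor `exp(-z²/2)` of the
kernel; the normalization of `u^σ` makes the remaining constant `1`. -/
theorem bargmannTransform_coherentState (σ : ℝ) (hσ : 0 < σ) (z : ℂ) :
    bargmannTransform σ (coherentState σ hσ) z = 1 := by
  have hs : (σ : ℂ) ≠ 0 := by exact_mod_cast hσ.ne'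
  have h0 : 0 < 2 * Real.pi * σ ^ 2 := by positivity
  set c : ℝ := 1 / (2 * Real.pi * σ ^ 2) ^ (1 / 4 : ℝ) with hc
  have hcc : c * c = (Real.sqrt (2 * Real.pi * σ ^ 2))⁻¹ := by
    rw [hc, ← sq, div_pow, one_pow, ← Real.rpow_mul_natCast h0.le, Real.sqrt_eq_rpow, one_div]
    norm_num
  have h1 : ∀ x : ℝ, bargmannKernel σ z x * coherentState σ hσ x =
      (c * c : ℝ) * Complex.exp (-(1 / (2 * σ ^ 2)) * x ^ 2 + z / σ * x + -z ^ 2 / 2) := by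
    intro x
    rw [bargmannKernel, coherentState_apply, ← hc]
    push_cast
    rw [mul_mul_mul_comm, ← Complex.exp_add]
    congr 2
    field_simp
    ring
  have h2 : (-(1 / (2 * (σ : ℂ) ^ 2))).re < 0 := by
    have : -(1 / (2 * (σ : ℂ) ^ 2)) = ((-(1 / (2 * σ ^ 2)) : ℝ) : ℂ) := by push_cast; rfl
    rw [this, Complex.ofReal_re, neg_lt_zero]
    positivity
  rw [bargmannTransform]
  simp only [h1]
  rw [integral_const_mul, integral_cexp_quadratic h2, hcc]
  have h3 : (Real.pi : ℂ) / -(-(1 / (2 * (σ : ℂ) ^ 2))) =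
      ((2 * Real.pi * σ ^ 2 : ℝ) : ℂ) := by
    push_cast
    field_simp
  have h4 : -z ^ 2 / 2 - (z / σ) ^ 2 / (4 * -(1 / (2 * (σ : ℂ) ^ 2))) = 0 := by
    field_simp
    ring
  have h5 : ((2 * Real.pi * σ ^ 2 : ℝ) : ℂ) ^ (1 / 2 : ℂ) =
      (Real.sqrt (2 * Real.pi * σ ^ 2) : ℝ) := by
    rw [Real.sqrt_eq_rpow, Complex.ofReal_cpow h0.le]
    norm_num
  rw [h3, h4, h5, Complex.exp_zero, mul_one, ← Complex.ofReal_mul,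
    inv_mul_cancel₀ (Real.sqrt_pos.2 h0).ne', Complex.ofReal_one]

theorem bargmannTransform_eigenfunction (m ω σ : ℝ) (hm : 0 < m) (hω : 0 < ω) (hσ : 0 < σ)
    (h : m * ω = 1 / (2 * σ ^ 2)) (n : ℕ) (z : ℂ) :
    bargmannTransform σ (oscillatorEigenfunction m ω hm hω n) z =
      (1 / Real.sqrt n.factorial : ℝ) * z ^ n := by
  have h1 : bargmannTransform σ ((creationOp m ω)^[n] (coherentState σ hσ)) z = z ^ n := by
    induction n with
    | zero => exact (bargmannTransform_coherentState σ hσ z).trans (pow_zero z).symm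
    | succ n ih =>
      rw [Function.iterate_succ_apply', bargmannTransform_creationOp m ω σ hσ h, ih, pow_succ']
  rw [oscillatorEigenfunction_eq m ω σ hm hω hσ h, ← h1]
  exact bargmannTransform_smul σ _ _ z

theorem bargmannTransformIsometry_eigenfunction (m ω σ : ℝ) (hm : 0 < m) (hω : 0 < ω)
    (hσ : 0 < σ) (h : m * ω = 1 / (2 * σ ^ 2)) (n : ℕ) :
    bargmannTransformIsometry σ hσ ((oscillatorEigenfunction m ω hm hω n).toLp 2 volume) =
      bargmannClass (bargmannMonomial n) := by
  rw [bargmannTransformIsometry_apply]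
  congr 1
  ext z
  rw [bargmannTransformₗ_apply, bargmannTransform_toLp,
    bargmannTransform_eigenfunction m ω σ hm hω hσ h, bargmannMonomial_apply]

/-- The range of an isometry on a complete space is closed, and here it contains the dense span of
the basis. -/
theorem LinearIsometry.surjective_of_hilbertBasis_mem_range {ι 𝕜 E F : Type*} [RCLike 𝕜]
    [NormedAddCommGroup E] [InnerProductSpace 𝕜 E] [CompleteSpace E]
    [NormedAddCommGroup F] [InnerProductSpace 𝕜 F] (T : E →ₗᵢ[𝕜] F) (b : HilbertBasis ι 𝕜 F)
    (hb : ∀ i, ∃ x, T x = b i) : Function.Surjective T := by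
  have hcl : IsClosed (LinearMap.range T.toLinearMap : Set F) := by
    rw [LinearMap.coe_range]
    exact T.isometry.isClosedEmbedding.isClosed_range
  have hle : Submodule.span 𝕜 (Set.range b) ≤ LinearMap.range T.toLinearMap := by
    rw [Submodule.span_le]
    rintro _ ⟨i, rfl⟩
    exact hb i
  have htop := (Submodule.topologicalClosure_minimal _ hle hcl)
  rw [b.dense_span] at htop
  exact fun y => htop (Submodule.mem_top (x := y))

theorem surjective_bargmannTransformIsometry (σ : ℝ) (hσ : 0 < σ) :
    Function.Surjective (bargmannTransformIsometry σ hσ) := by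
  refine LinearIsometry.surjective_of_hilbertBasis_mem_range _ bargmannBasis fun n => ?_
  -- Any oscillator with `mω = 1/(2σ²)` supplies preimages of the basis; `m = 1` is chosen.
  have hω : 0 < 1 / (2 * σ ^ 2) := by positivity
  exact ⟨_, (bargmannTransformIsometry_eigenfunction 1 _ σ one_pos hω hσ (one_mul _) n).trans
    (bargmannBasis_apply n).symm⟩

theorem theorem6p8 :
    -- square-integrable entire functions form a closed subspace of `L²`, hence a Hilbert space
    Function.Injective bargmannToL2 ∧
    IsClosed (bargmannSpace : Set (Lp ℂ 2 bargmannMeasure)) ∧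
    CompleteSpace bargmannSpace ∧
    (∀ f g : bargmannFunctions, inner ℂ (bargmannClass f) (bargmannClass g) =
      (1 / Real.pi : ℝ) * ∫ z : ℂ, starRingEnd ℂ (f.1 z) * g.1 z * Real.exp (-‖z‖ ^ 2)) ∧
    -- description by power series
    (∀ f ∈ bargmannFunctions, ∃! a : ℕ → ℂ, ∀ z : ℂ, HasSum (fun n => a n * z ^ n) (f z)) ∧
    (∀ a : ℕ → ℂ,
      ((∀ z : ℂ, Summable (fun n => a n * z ^ n)) ∧
          (fun z : ℂ => ∑' n, a n * z ^ n) ∈ bargmannFunctions) ↔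
        Summable (fun n => ‖a n‖ ^ 2 * (n.factorial : ℝ))) ∧
    -- the normalized monomials
    ∃ e : ℕ → bargmannFunctions,
      (∀ n z, (e n).1 z = (1 / Real.sqrt n.factorial : ℝ) * z ^ n) ∧
      (∃ b : HilbertBasis ℕ ℂ bargmannSpace, ∀ n, b n = bargmannClass (e n)) ∧
      (∀ (f : bargmannFunctions) (a : ℕ → ℂ),
        (∀ z : ℂ, HasSum (fun n => a n * z ^ n) (f.1 z)) →
          (∀ n, inner ℂ (bargmannClass (e n)) (bargmannClass f) =
            a n * (Real.sqrt n.factorial : ℝ)) ∧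
          ∀ α : ℕ → ℂ, HasSum (fun n => α n • bargmannClass (e n)) (bargmannClass f) ↔
            ∀ n, α n = a n * (Real.sqrt n.factorial : ℝ)) ∧
      -- the isometries generated by the coherent state
      ∀ (σ : ℝ) (hσ : 0 < σ),
        (∃ V : Lp ℂ 2 (volume : Measure ℝ) →ₗᵢ[ℂ] Lp ℂ 2 (volume : Measure (ℝ × ℝ)),
          (∀ ψ, V ψ =ᵐ[volume] phaseSpaceFunction (coherentState σ hσ) ψ ∧
            ContDiff ℝ ((⊤ : ℕ∞) : WithTop ℕ∞) (phaseSpaceFunction (coherentState σ hσ) ψ)) ∧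
          CompleteSpace (LinearMap.range V.toLinearMap)) ∧
        ∃ Vhat : Lp ℂ 2 (volume : Measure ℝ) ≃ₗᵢ[ℂ] bargmannSpace,
          (∀ ψ, ∃ f : bargmannFunctions, Vhat ψ = bargmannClass f ∧
            ∀ q p : ℝ,
              f.1 (phasePoint σ q p) =
                  Real.sqrt (2 * Real.pi) * Real.exp (‖phasePoint σ q p‖ ^ 2 / 2) *
                    Complex.exp (Complex.I * (q * p / 2)) *
                    phaseSpaceFunction (coherentState σ hσ) ψ (q, p) ∧
              f.1 (phasePoint σ q p) =
                  Real.exp (‖phasePoint σ q p‖ ^ 2 / 2) *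
                    Complex.exp (Complex.I * (q * p / 2)) *
                    inner ℂ (phaseShiftL2 (coherentState σ hσ) q p) ψ) ∧
          ∀ (m ω : ℝ) (hm : 0 < m) (hω : 0 < ω), m * ω = 1 / (2 * σ ^ 2) →
            ∀ n : ℕ,
              oscillatorHamiltonian m ω (oscillatorEigenfunction m ω hm hω n) =
                ((ω * (n + 1 / 2) : ℝ) : ℂ) • oscillatorEigenfunction m ω hm hω n ∧
              Vhat ((oscillatorEigenfunction m ω hm hω n).toLp 2 volume) =
                bargmannClass (e n) := by
  refine ⟨injective_bargmannToL2, isClosed_bargmannSpace, completeSpace_bargmannSpace,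
    inner_bargmannClass, fun f hf => ?_, summable_and_mem_bargmannFunctions_iff,
    bargmannMonomial, bargmannMonomial_apply, ⟨bargmannBasis, bargmannBasis_apply⟩,
    fun f a ha => ⟨fun n => ?_, fun α => ?_⟩, fun σ hσ => ⟨⟨phaseSpaceIsometry σ hσ,
      fun ψ => ⟨phaseSpaceIsometry_coeFn σ hσ ψ, contDiff_phaseSpaceFunction σ hσ ψ⟩, ?_⟩,
      LinearIsometryEquiv.ofSurjective (bargmannTransformIsometry σ hσ)
        (surjective_bargmannTransformIsometry σ hσ), fun ψ => ⟨bargmannTransformₗ σ hσ ψ,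
          rfl, fun q p => ⟨?_, bargmannTransform_phasePoint σ hσ ψ q p⟩⟩,
      fun m ω hm hω h n => ⟨oscillatorHamiltonian_eigenfunction m ω σ hm hω hσ h n,
        bargmannTransformIsometry_eigenfunction m ω σ hm hω hσ h n⟩⟩⟩
  · obtain ⟨a, ha⟩ := exists_hasSum_pow hf.1
    exact ⟨a, ha, fun b hb => coeff_eq_of_hasSum_pow hb ha⟩
  · rw [← bargmannBasis_repr f ha, bargmannBasis.repr_apply_apply, bargmannBasis_apply]
  · simp only [← bargmannBasis_repr f ha, ← bargmannBasis_apply]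
    exact bargmannBasis.hasSum_smul_iff _ α
  · exact (phaseSpaceIsometry σ hσ).isometry.isUniformInducing.isComplete_range.completeSpace_coe
  · refine (bargmannTransform_phasePoint σ hσ ψ q p).trans ?_
    have h : ((Real.sqrt (2 * Real.pi) : ℝ) : ℂ) ≠ 0 := by
      exact_mod_cast (Real.sqrt_pos.2 Real.two_pi_pos).ne'
    rw [phaseSpaceFunction]
    push_cast
    field_simp
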